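/- **Setting.** Let $M$ be a smooth $d$-dimensional manifold (without boundary, Hausdorff, second countable), oriented by a smooth nowhere vanishing volume form $\mathrm{Vol}$, and let $W_p:\mathrm{Hom}(T_pM,\mathbb{R}^d)\to(-\infty,\infty]$, $p\in M$, be a constitutive relation. A *reference chart* for an archetype $w:\mathrm{Hom}(\mathbb{R}^d,\mathbb{R}^d)\to(-\infty,\infty]$ is a pair $(U,P)$ of an open set $U\subset M$ and a smooth $\mathbb{R}^d$-valued one-form $P$ on $U$ such that, for every $p\in U$, $P(p):T_pM\to\mathbb{R}^d$ is an isomorphism with $\mathrm{Vol}(p)=P(p)^*dx$, and $W_p(A)=w(A\circ P(p)^{-1})$ for all $A\in\mathrm{Hom}(T_pM,\mathbb{R}^d)$. The archetype is *undistorted* if its symmetry group $\{g\in \mathrm{GL}(d): w(B\circ g)=w(B)\ \text{for all } B\}$ is contained in $\mathrm{SO}(d)$. Let $(M,W,\mathrm{Vol})$ be a smooth uniform solid body, i.e. let $w$ be an undistorted archetype and $(U_\alpha,P_\alpha)_\alpha$ reference charts for $w$ whose domains cover $M$. These define a Riemannian metric on $M$ by $$G_p(X,Y)=P_\alpha(p)(X)\cdot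 P_\alpha(p)(Y),\qquad p\in U_\alpha,\ X,Y\in T_pM,$$ which does not depend on the choice of $\alpha$. The body has *discrete defects* if $dP_\alpha=0$ for all $\alpha$. A sub-body (open subset) $M'\subset M$ has *no disclinations* if there is a reference chart $(M',P')$ for $w$ with $dP'=0$. A *material connection* is an affine connection on $M$ such that for every piecewise $C^1$ path $\gamma$ from $p$ to $q$, with parallel transport $\Pi_\gamma:T_pM\to T_qM$, and every $A\in\mathrm{Hom}(T_qM,\mathbb{R}^d)$, one has $W_p(A\circ\Pi_\gamma)=W_q(A)$. **Proposition (Existence of material connection).** Suppose that the body has discrete defects. Then the Levi-Civita connection $\nabla$ of $G$ exists and is a material connection. Moreover: 1. $\nabla$ is locally flat, i.e. its Riemannian curvature vanishes; 2. $\nabla$ has trivial holonomy on every sub-body $M'$ with no disclinations: $\Pi_\gamma=\mathrm{Id}_{T_pM}$ for every piecewise $C^1$ closed curve $\gamma$ in $M'$ based at $p$; 3. for every $\alpha$ and every piecewise $C^1$ curve $\gamma$ contained in $U_\alpha$ from $p$ to $q$, $\Pi_\gamma=P_\alpha(q)^{-1}P_\alpha(p)$. -/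

import Mathlib

open Set Bundle
open scoped Manifold ContDiff Topology

noncomputable section

/-- The Euclidean space `ℝ^d`. -/
abbrev Euc (d : ℕ) : Type := EuclideanSpace ℝ (Fin d)

/-! ### `ℝ^d`-valued one-forms -/

section OneForms

variable {d : ℕ} {M : Type*} [TopologicalSpace M] [ChartedSpace (Euc d) M]
  [IsManifold (𝓡 d) ∞ M]

/-- A family of linear maps `η p : T_p M → ℝ^d` is a smooth one-form on `U`: it is smooth on `U` as
a section of the bundle `Hom(TM, ℝ^d)`. -/
def IsSmoothOneFormOn
    (η : ∀ p : M, TangentSpace (𝓡 d) p →L[ℝ] Euc d) (U : Set M) : Prop :=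
  ContMDiffOn (𝓡 d) ((𝓡 d).prod 𝓘(ℝ, Euc d →L[ℝ] Euc d)) ∞
    (fun p ↦ TotalSpace.mk' (Euc d →L[ℝ] Euc d)
      (E := fun p : M ↦ (TangentSpace (𝓡 d) p →L[ℝ] Bundle.Trivial M (Euc d) p)) p (η p)) U

/-- The value at `p` of the exterior derivative of the `ℝ^d`-valued one-form `η` on the vector
fields `X`, `Y`: `dη(X, Y) = X(η(Y)) - Y(η(X)) - η([X, Y])`. -/
def extDerivOneForm (η : ∀ p : M, TangentSpace (𝓡 d) p →L[ℝ] Euc d)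
    (X Y : ∀ p : M, TangentSpace (𝓡 d) p) (p : M) : Euc d :=
  mvfderiv (𝓡 d) (fun q ↦ η q (Y q)) p (X p) - mvfderiv (𝓡 d) (fun q ↦ η q (X q)) p (Y p)
    - η p (VectorField.mlieBracket (𝓡 d) X Y p)

/-- The one-form `η` is closed on the open set `U`: `dη = 0` on `U`. -/
def IsClosedOneFormOn (η : ∀ p : M, TangentSpace (𝓡 d) p →L[ℝ] Euc d) (U : Set M) : Prop :=
  ∀ p ∈ U, ∀ X Y : ∀ p : M, TangentSpace (𝓡 d) p,
    MDifferentiableAt (𝓡 d) (𝓡 d).tangent (fun q ↦ (⟨q, X q⟩ : TangentBundle (𝓡 d) M)) p →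
    MDifferentiableAt (𝓡 d) (𝓡 d).tangent (fun q ↦ (⟨q, Y q⟩ : TangentBundle (𝓡 d) M)) p →
    extDerivOneForm η X Y p = 0

end OneForms

/-! ### Bodies -/

/-- A hyperelastic body with body manifold `M`: a (smooth, nowhere vanishing) volume form and a
constitutive relation `W : T^*M ⊗ ℝ^d → (-∞, ∞]`. The manifold is oriented by the volume form. -/
structure HyperelasticBody (d : ℕ) (M : Type*) [TopologicalSpace M] [ChartedSpace (Euc d) M]
    [IsManifold (𝓡 d) ∞ M] where
  vol : ∀ p : M, TangentSpace (𝓡 d) p [⋀^Fin d]→L[ℝ] ℝ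
  vol_ne_zero : ∀ p, vol p ≠ 0
  vol_smooth : ContMDiff (𝓡 d) ((𝓡 d).prod 𝓘(ℝ, Euc d [⋀^Fin d]→L[ℝ] ℝ)) ∞
    (fun p ↦ TotalSpace.mk' (Euc d [⋀^Fin d]→L[ℝ] ℝ)
      (E := fun p : M ↦ (TangentSpace (𝓡 d) p [⋀^Fin d]→L[ℝ] Bundle.Trivial M ℝ p)) p (vol p))
  W : ∀ p : M, (TangentSpace (𝓡 d) p →L[ℝ] Euc d) → WithTop ℝ

/-- The symmetry group of an archetype `w : ℝ^d ⊗ ℝ^d → (-∞, ∞]`: all `g ∈ GL(d)` with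
`w (B ∘ g) = w B` for every `B`. -/
def symmetryGroup {d : ℕ} (w : (Euc d →L[ℝ] Euc d) → WithTop ℝ) :
    Subgroup (Euc d ≃L[ℝ] Euc d) where
  carrier := {g | ∀ B : Euc d →L[ℝ] Euc d, w (B ∘L (g : Euc d →L[ℝ] Euc d)) = w B}
  one_mem' B := congrArg w (ContinuousLinearMap.ext fun _ ↦ rfl)
  mul_mem' {g h} hg hh B := by
    have e : B ∘L ((g * h : Euc d ≃L[ℝ] Euc d) : Euc d →L[ℝ] Euc d)
        = (B ∘L (g : Euc d →L[ℝ] Euc d)) ∘L (h : Euc d →L[ℝ] Euc d) :=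
      ContinuousLinearMap.ext fun _ ↦ rfl
    rw [e, hh, hg]
  inv_mem' {g} hg B := by
    rw [← hg (B ∘L ((g⁻¹ : Euc d ≃L[ℝ] Euc d) : Euc d →L[ℝ] Euc d))]
    congr 1
    ext1 x
    exact congrArg B (g.symm_apply_apply x)

/-- The archetype is undistorted: its symmetry group is contained in `SO(d)`. -/
def IsUndistorted {d : ℕ} (w : (Euc d →L[ℝ] Euc d) → WithTop ℝ) : Prop :=
  ∀ g ∈ symmetryGroup w, (∀ v : Euc d, ‖g v‖ = ‖v‖) ∧
    LinearMap.det ((g : Euc d →L[ℝ] Euc d) : Euc d →ₗ[ℝ] Euc d) = 1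

namespace HyperelasticBody

variable {d : ℕ} {M : Type*} [TopologicalSpace M] [ChartedSpace (Euc d) M]
  [IsManifold (𝓡 d) ∞ M]

/-- `(U, P)` is a reference chart of the body with archetype `w`: `U` is open, `P` is a smooth
one-form on `U` which is, at each `p ∈ U`, a volume-preserving isomorphism `T_p M → ℝ^d`, and
`W_p(A) = w(A ∘ P(p)⁻¹)` for `p ∈ U`. The values of `P` outside `U` are irrelevant. -/
structure IsReferenceChart (B : HyperelasticBody d M)
    (w : (Euc d →L[ℝ] Euc d) → WithTop ℝ)
    (U : Set M) (P : ∀ p : M, TangentSpace (𝓡 d) p ≃L[ℝ] Euc d) : Prop where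
  isOpen : IsOpen U
  smooth : IsSmoothOneFormOn (fun p ↦ (P p : TangentSpace (𝓡 d) p →L[ℝ] Euc d)) U
  volume_preserving : ∀ p ∈ U, ∀ v : Fin d → TangentSpace (𝓡 d) p,
    B.vol p v = (EuclideanSpace.basisFun (Fin d) ℝ).toBasis.det (fun i ↦ P p (v i))
  constitutive : ∀ p ∈ U, ∀ A : TangentSpace (𝓡 d) p →L[ℝ] Euc d,
    B.W p A = w (A ∘L ((P p).symm : Euc d →L[ℝ] TangentSpace (𝓡 d) p))

/-- A representation `(M, {U_α, P_α}, w)` of the body `B` as a smooth uniform solid body, with an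
undistorted archetype `w`. -/
structure UniformRepresentation (B : HyperelasticBody d M)
    (ι : Type*) where
  archetype : (Euc d →L[ℝ] Euc d) → WithTop ℝ
  undistorted : IsUndistorted archetype
  U : ι → Set M
  P : ι → ∀ p : M, TangentSpace (𝓡 d) p ≃L[ℝ] Euc d
  isReferenceChart : ∀ α, B.IsReferenceChart archetype (U α) (P α)
  cover : ⋃ α, U α = univ

namespace UniformRepresentation

variable {B : HyperelasticBody d M} {ι : Type*}

/-- A body with discrete defects: every reference map is closed. -/
def HasDiscreteDefects (R : B.UniformRepresentation ι) : Prop :=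
  ∀ α, IsClosedOneFormOn (fun p ↦ (R.P α p : TangentSpace (𝓡 d) p →L[ℝ] Euc d)) (R.U α)

/-- The sub-body `M'` has no disclinations: one can add to the lattice structure a reference
neighborhood `(M', P')` with `P'` closed. -/
def HasNoDisclinations (R : B.UniformRepresentation ι) (M' : Set M) : Prop :=
  ∃ P' : ∀ p : M, TangentSpace (𝓡 d) p ≃L[ℝ] Euc d,
    B.IsReferenceChart R.archetype M' P' ∧
    IsClosedOneFormOn (fun p ↦ (P' p : TangentSpace (𝓡 d) p →L[ℝ] Euc d)) M'

/-- The inner product `(X, Y) ↦ P_α(p)(X) · P_α(p)(Y)` on `T_p M`. -/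
def pullbackInner (R : B.UniformRepresentation ι) (α : ι) (p : M) :
    TangentSpace (𝓡 d) p →L[ℝ] TangentSpace (𝓡 d) p →L[ℝ] ℝ :=
  (ContinuousLinearMap.precomp ℝ (R.P α p : TangentSpace (𝓡 d) p →L[ℝ] Euc d)).comp
    ((innerSL ℝ : Euc d →L[ℝ] Euc d →L[ℝ] ℝ).comp
      (R.P α p : TangentSpace (𝓡 d) p →L[ℝ] Euc d))

theorem pullbackInner_apply (R : B.UniformRepresentation ι) (α : ι) (p : M)
    (X Y : TangentSpace (𝓡 d) p) :
    R.pullbackInner α p X Y = inner ℝ (R.P α p X) (R.P α p Y) := rfl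

/-- As the archetype is undistorted, the inner product does not depend on the reference chart. -/
theorem pullbackInner_eq (R : B.UniformRepresentation ι) {α β : ι} {p : M}
    (hα : p ∈ R.U α) (hβ : p ∈ R.U β) : R.pullbackInner α p = R.pullbackInner β p := by
  let g : Euc d ≃L[ℝ] Euc d := (R.P β p).symm.trans (R.P α p)
  have hg : g ∈ symmetryGroup R.archetype := fun C ↦ by
    have h1 := (R.isReferenceChart α).constitutive p hα
      (C ∘L (R.P α p : TangentSpace (𝓡 d) p →L[ℝ] Euc d))
    have h2 := (R.isReferenceChart β).constitutive p hβ
      (C ∘L (R.P α p : TangentSpace (𝓡 d) p →L[ℝ] Euc d))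
    rw [h1] at h2
    refine Eq.trans h2.symm ?_
    congr 1
    ext1 x
    exact congrArg C ((R.P α p).apply_symm_apply x)
  have hn := (R.undistorted g hg).1
  let gi : Euc d →ₗᵢ[ℝ] Euc d := ⟨(g : Euc d →L[ℝ] Euc d), hn⟩
  ext X Y
  have h := gi.inner_map_map (R.P β p X) (R.P β p Y)
  rw [pullbackInner_apply, pullbackInner_apply, ← h]
  have e : ∀ Z, gi (R.P β p Z) = R.P α p Z := fun Z ↦
    congrArg (R.P α p) ((R.P β p).symm_apply_apply Z)
  rw [e, e]

theorem exists_mem (R : B.UniformRepresentation ι) (p : M) : ∃ α, p ∈ R.U α :=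
  mem_iUnion.1 (R.cover ▸ mem_univ p)

theorem contMDiffAt_pullbackInner (R : B.UniformRepresentation ι) {α : ι} {p : M}
    (hα : p ∈ R.U α) :
    ContMDiffAt (𝓡 d) ((𝓡 d).prod 𝓘(ℝ, Euc d →L[ℝ] Euc d →L[ℝ] ℝ)) ∞
      (fun q ↦ TotalSpace.mk' (Euc d →L[ℝ] Euc d →L[ℝ] ℝ)
        (E := fun q : M ↦ (TangentSpace (𝓡 d) q →L[ℝ] TangentSpace (𝓡 d) q →L[ℝ] ℝ))
        q (R.pullbackInner α q)) p := by
  have hs := ((R.isReferenceChart α).smooth p hα).contMDiffAt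
    ((R.isReferenceChart α).isOpen.mem_nhds hα)
  rw [contMDiffAt_hom_bundle] at hs ⊢
  refine ⟨contMDiffAt_id, ?_⟩
  have hF : ContDiff ℝ ∞ (fun Q : Euc d →L[ℝ] Euc d ↦
      (ContinuousLinearMap.compL ℝ (Euc d) (Euc d) ℝ).flip Q ∘L
        ((innerSL ℝ : Euc d →L[ℝ] Euc d →L[ℝ] ℝ) ∘L Q)) := by
    fun_prop
  have hc := hF.contMDiff.contMDiffAt.comp p hs.2
  refine hc.congr_of_eventuallyEq ?_
  have hb := (trivializationAt (Euc d) (fun q : M ↦ TangentSpace (𝓡 d) q) p).open_baseSet.mem_nhds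
    (mem_baseSet_trivializationAt (Euc d) (fun q : M ↦ TangentSpace (𝓡 d) q) p)
  filter_upwards [hb] with q hq
  ext v w
  rw [inCoordinates_apply_eq₂ hq hq (mem_univ _)]
  simp [pullbackInner_apply, ContinuousLinearMap.inCoordinates]
  have e : ∀ u : Euc d, (trivializationAt (Euc d) (TangentSpace (𝓡 d) : M → Type _) p).symmL ℝ q u
      = (trivializationAt (Euc d) (TangentSpace (𝓡 d) : M → Type _) p).symm q u := fun u ↦
    Trivialization.symmL_apply _ hq u
  rw [e, e]
  exact (innerSL_apply_apply ℝ _ _).symm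

/-- The Riemannian metric of the body, `G_p(X, Y) = P_α(p)(X) · P_α(p)(Y)` for `p ∈ U_α`. -/
def metric (R : B.UniformRepresentation ι) :
    ContMDiffRiemannianMetric (𝓡 d) ∞ (Euc d) (fun p : M ↦ TangentSpace (𝓡 d) p) where
  inner p := R.pullbackInner (R.exists_mem p).choose p
  symm p v w := by
    simp only [pullbackInner_apply]
    exact real_inner_comm _ _
  pos p v hv := by
    rw [pullbackInner_apply]
    exact real_inner_self_pos.2 (by simpa using hv)
  isVonNBounded p := by
    set α := (R.exists_mem p).choose
    have h := (NormedSpace.isVonNBounded_ball ℝ (Euc d) 1).image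
      ((R.P α p).symm : Euc d →L[ℝ] TangentSpace (𝓡 d) p)
    refine Bornology.IsVonNBounded.subset ?_ h
    intro v hv
    refine ⟨R.P α p v, ?_, (R.P α p).symm_apply_apply v⟩
    have hv' : inner ℝ (R.P α p v) (R.P α p v) < (1 : ℝ) := hv
    rw [real_inner_self_eq_norm_sq] at hv'
    rw [mem_ball_zero_iff]
    nlinarith [norm_nonneg (R.P α p v)]
  contMDiff p := by
    obtain ⟨α, hα⟩ := R.exists_mem p
    refine (R.contMDiffAt_pullbackInner hα).congr_of_eventuallyEq ?_
    filter_upwards [(R.isReferenceChart α).isOpen.mem_nhds hα] with q hq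
    rw [R.pullbackInner_eq (R.exists_mem q).choose_spec hq]

theorem metric_inner (R : B.UniformRepresentation ι) {α : ι} {p : M} (hα : p ∈ R.U α)
    (X Y : TangentSpace (𝓡 d) p) :
    R.metric.inner p X Y = inner ℝ (R.P α p X) (R.P α p Y) := by
  rw [← pullbackInner_apply, ← R.pullbackInner_eq (R.exists_mem p).choose_spec hα]
  rfl

end UniformRepresentation

end HyperelasticBody

/-! ### Affine connections -/

/-- The curve `γ` restricted to `[a, b]` (with `a ≤ b`) is piecewise `C^1`: there is a partition
`a = t 0 ≤ t 1 ≤ ... ≤ t n = b` such that `γ` is `C^1` on each `[t i, t (i + 1)]`. -/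
def IsPiecewiseC1 (d : ℕ) {M : Type*} [TopologicalSpace M] [ChartedSpace (Euc d) M] (γ : ℝ → M) (a b : ℝ) : Prop :=
  ∃ (n : ℕ) (t : ℕ → ℝ), Monotone t ∧ t 0 = a ∧ t n = b ∧
    ∀ i < n, ContMDiffOn 𝓘(ℝ, ℝ) (𝓡 d) 1 γ (Icc (t i) (t (i + 1)))

section Connections

variable {d : ℕ} {M : Type*} [TopologicalSpace M] [ChartedSpace (Euc d) M]
  [IsManifold (𝓡 d) ∞ M]

/-- The covariant derivative `cov` on `TM` is the Levi-Civita connection of the Riemannian metric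
`g`: it is torsion-free and compatible with `g`. -/
def IsLeviCivita (g : ContMDiffRiemannianMetric (𝓡 d) ∞ (Euc d) (fun p : M ↦ TangentSpace (𝓡 d) p))
    (cov : CovariantDerivative (𝓡 d) (Euc d) (fun p : M ↦ TangentSpace (𝓡 d) p)) : Prop :=
  letI : RiemannianBundle (fun p : M ↦ TangentSpace (𝓡 d) p) := ⟨g.toRiemannianMetric⟩
  cov.torsion = 0 ∧ cov.IsMetricCompatible

variable (cov : CovariantDerivative (𝓡 d) (Euc d) (fun p : M ↦ TangentSpace (𝓡 d) p))

/-- The connection is locally flat: its Riemannian curvature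
`R(X, Y)Z = ∇_X ∇_Y Z - ∇_Y ∇_X Z - ∇_[X, Y] Z` vanishes. -/
def IsLocallyFlat : Prop :=
  ∀ (p : M) (X Y Z : ∀ q : M, TangentSpace (𝓡 d) q),
    ContMDiffAt (𝓡 d) (𝓡 d).tangent ∞ (fun q ↦ (⟨q, X q⟩ : TangentBundle (𝓡 d) M)) p →
    ContMDiffAt (𝓡 d) (𝓡 d).tangent ∞ (fun q ↦ (⟨q, Y q⟩ : TangentBundle (𝓡 d) M)) p →
    ContMDiffAt (𝓡 d) (𝓡 d).tangent ∞ (fun q ↦ (⟨q, Z q⟩ : TangentBundle (𝓡 d) M)) p →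
    cov (fun q ↦ cov Z q (Y q)) p (X p) - cov (fun q ↦ cov Z q (X q)) p (Y p)
      - cov Z p (VectorField.mlieBracket (𝓡 d) X Y p) = 0

/-- The vector field `V` along the curve `γ` has covariant derivative `DV/dt = w` at time `t`.
If `V = ∑ cⁱ sᵢ(γ)` in a local frame `sᵢ` around `γ t`, this derivative is
`∑ (cⁱ)' sᵢ + ∑ cⁱ ∇_{γ'} sᵢ`; here the frame is the one of the trivialization of `TM` at `γ t`,
and `FiberBundle.extend _ (V t)` is the section with the constant coordinates `cⁱ(t)`. -/
def HasCovDerivAlongAt (γ : ℝ → M) (V : ∀ t : ℝ, TangentSpace (𝓡 d) (γ t)) (t : ℝ)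
    (w : TangentSpace (𝓡 d) (γ t)) : Prop :=
  MDifferentiableAt 𝓘(ℝ, ℝ) (𝓡 d) γ t ∧
  HasDerivAt
    (fun s ↦ (trivializationAt (Euc d) (fun p : M ↦ TangentSpace (𝓡 d) p) (γ t) ⟨γ s, V s⟩).2)
    (trivializationAt (Euc d) (fun p : M ↦ TangentSpace (𝓡 d) p) (γ t)
      ⟨γ t, w - cov (FiberBundle.extend (Euc d) (V t)) (γ t)
        (mfderiv 𝓘(ℝ, ℝ) (𝓡 d) γ t (1 : ℝ))⟩).2 t

/-- `V` is a parallel vector field along the piecewise `C^1` curve `γ` on `[a, b]`: it is continuous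
and `DV/dt = 0` except at finitely many times. -/
def IsParallelAlong (γ : ℝ → M) (a b : ℝ) (V : ∀ t : ℝ, TangentSpace (𝓡 d) (γ t)) : Prop :=
  ContinuousOn (fun t ↦ (⟨γ t, V t⟩ : TangentBundle (𝓡 d) M)) (Icc a b) ∧
  ∃ S : Finset ℝ, ∀ t ∈ Ioo a b \ S, HasCovDerivAlongAt cov γ V t 0

/-- `T : T_p M → T_q M` is the parallel transport along the curve `γ` on `[a, b]` from `p` to `q`:
every vector `v ∈ T_p M` is the initial value of a parallel field along `γ`, and every such field
has the final value `T v`. -/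
def IsParallelTransport (γ : ℝ → M) (a b : ℝ) {p q : M}
    (T : TangentSpace (𝓡 d) p →L[ℝ] TangentSpace (𝓡 d) q) : Prop :=
  γ a = p ∧ γ b = q ∧ ∀ v : TangentSpace (𝓡 d) p,
    (∃ V, IsParallelAlong cov γ a b V ∧ (⟨γ a, V a⟩ : TangentBundle (𝓡 d) M) = ⟨p, v⟩) ∧
    ∀ V, IsParallelAlong cov γ a b V → (⟨γ a, V a⟩ : TangentBundle (𝓡 d) M) = ⟨p, v⟩ →
      (⟨γ b, V b⟩ : TangentBundle (𝓡 d) M) = ⟨q, T v⟩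

/-- `cov` is a material connection of the body: it is a smooth affine connection whose parallel
transport leaves `W` invariant, `W_p(A ∘ Π_γ) = W_q(A)` for every path `γ` from `p` to `q` and
every `A ∈ T_q^*M ⊗ ℝ^d`. -/
def IsMaterialConnection (B : HyperelasticBody d M) : Prop :=
  CovariantDerivative.ContMDiffCovariantDerivative cov ∞ ∧
  ∀ (γ : ℝ → M) (a b : ℝ), IsPiecewiseC1 d γ a b →
    ∃ T : TangentSpace (𝓡 d) (γ a) →L[ℝ] TangentSpace (𝓡 d) (γ b),
      IsParallelTransport cov γ a b T ∧
      ∀ A : TangentSpace (𝓡 d) (γ b) →L[ℝ] Euc d, B.W (γ a) (A ∘L T) = B.W (γ b) A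

/-- The connection has trivial holonomy on `M'`: parallel transport along every closed curve in
`M'` is the identity. -/
def HasTrivialHolonomyOn (M' : Set M) : Prop :=
  ∀ (γ : ℝ → M) (a b : ℝ) (p : M), IsPiecewiseC1 d γ a b → (∀ t ∈ Icc a b, γ t ∈ M') →
    γ a = p → γ b = p →
    IsParallelTransport cov γ a b (ContinuousLinearMap.id ℝ (TangentSpace (𝓡 d) p))

end Connections

end

/-! A coframe `P` carries the connection `P⁻¹ d(P σ)` (`coframeDeriv`): differentiate the
coordinates of `σ` and map back. Applying `P` to its torsion gives `dP`, so it is torsion-free when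
`P` is closed, and the product rule makes it compatible with the pullback by `P` of the Euclidean
inner product. Uniqueness of the Levi-Civita connection, proved pointwise in
`IsLeviCivita.eq_coframeDeriv`, then identifies it with `∇` on the domain of `P`.

Reference maps of an undistorted archetype differ by isometries, so this applies to every closed
reference chart, those of the atlas and the chart `P'` of a disclination-free sub-body alike
(`isFlatWith`). Read through such a `P`, the connection is plain differentiation of `ℝ^d`-valued
functions: curvature is the defect of commutation of second derivatives, which is zero, and parallel
fields have constant coordinates, so transport from `p` to `q` is `P(q)⁻¹ P(p)`. This is the
identity on loops, and it gives `W_p(A ∘ Π) = w(A ∘ P(q)⁻¹) = W_q(A)`. A general path is cut into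
pieces lying in single charts, and the transports are composed. -/

noncomputable section

/-! ### Smooth coframes and their inverses -/

section Coframes

variable {d : ℕ} {M : Type*} [TopologicalSpace M] [ChartedSpace (Euc d) M]
  [IsManifold (𝓡 d) ∞ M]
  {EN : Type*} [NormedAddCommGroup EN] [NormedSpace ℝ EN] {HN : Type*} [TopologicalSpace HN]
  {IN : ModelWithCorners ℝ EN HN} {N : Type*} [TopologicalSpace N] [ChartedSpace HN N]

/-- Evaluating a smooth one-form on a `C^n` field of tangent vectors along a map. -/
theorem IsSmoothOneFormOn.contMDiffWithinAt_apply
    {η : ∀ p : M, TangentSpace (𝓡 d) p →L[ℝ] Euc d} {U : Set M} (hη : IsSmoothOneFormOn η U)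
    (hU : IsOpen U) {n : WithTop ℕ∞} (hn : n ≤ ∞) {b : N → M}
    {v : ∀ x, TangentSpace (𝓡 d) (b x)} {s : Set N} {x : N} (hx : b x ∈ U)
    (hv : ContMDiffWithinAt IN (𝓡 d).tangent n
      (fun y ↦ (⟨b y, v y⟩ : TangentBundle (𝓡 d) M)) s x) :
    ContMDiffWithinAt IN 𝓘(ℝ, Euc d) n (fun y ↦ η (b y) (v y)) s x := by
  have h1 := ((hη _ hx).contMDiffAt (hU.mem_nhds hx)).of_le hn
  have hb : ContMDiffWithinAt IN (𝓡 d) n b s x := (contMDiffWithinAt_totalSpace.1 hv).1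
  have h2 := h1.comp_contMDiffWithinAt x hb
  have h3 := ContMDiffWithinAt.clm_bundle_apply (E₁ := fun p : M ↦ TangentSpace (𝓡 d) p)
    (E₂ := Bundle.Trivial M (Euc d)) (ϕ := fun y ↦ η (b y)) (v := v) h2 hv
  exact (contMDiffWithinAt_totalSpace.1 h3).2

theorem IsSmoothOneFormOn.contMDiffAt_apply
    {η : ∀ p : M, TangentSpace (𝓡 d) p →L[ℝ] Euc d} {U : Set M} (hη : IsSmoothOneFormOn η U)
    (hU : IsOpen U) {n : WithTop ℕ∞} (hn : n ≤ ∞) {σ : ∀ p : M, TangentSpace (𝓡 d) p} {p : M}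
    (hp : p ∈ U)
    (hσ : ContMDiffAt (𝓡 d) (𝓡 d).tangent n (fun q ↦ (⟨q, σ q⟩ : TangentBundle (𝓡 d) M)) p) :
    ContMDiffAt (𝓡 d) 𝓘(ℝ, Euc d) n (fun q ↦ η q (σ q)) p :=
  hη.contMDiffWithinAt_apply hU hn (b := id) hp hσ

theorem IsSmoothOneFormOn.mdifferentiableAt_apply
    {η : ∀ p : M, TangentSpace (𝓡 d) p →L[ℝ] Euc d} {U : Set M} (hη : IsSmoothOneFormOn η U)
    (hU : IsOpen U) {σ : ∀ p : M, TangentSpace (𝓡 d) p} {p : M} (hp : p ∈ U)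
    (hσ : MDifferentiableAt (𝓡 d) (𝓡 d).tangent
      (fun q ↦ (⟨q, σ q⟩ : TangentBundle (𝓡 d) M)) p) :
    MDifferentiableAt (𝓡 d) 𝓘(ℝ, Euc d) (fun q ↦ η q (σ q)) p := by
  have h1 := ((hη _ hp).contMDiffAt (hU.mem_nhds hp)).mdifferentiableAt (by simp)
  have h3 := MDifferentiableAt.clm_bundle_apply (E₁ := fun p : M ↦ TangentSpace (𝓡 d) p)
    (E₂ := Bundle.Trivial M (Euc d)) (ϕ := fun y ↦ η y) (v := σ) h1 hσ
  exact ((mdifferentiableAt_totalSpace ..).1 h3).2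

/-- A smooth one-form read in the trivialization of the tangent bundle at `p`. -/
theorem IsSmoothOneFormOn.contMDiffAt_comp_symmL
    {η : ∀ p : M, TangentSpace (𝓡 d) p →L[ℝ] Euc d} {U : Set M} (hη : IsSmoothOneFormOn η U)
    (hU : IsOpen U) {p : M} (hp : p ∈ U) :
    ContMDiffAt (𝓡 d) 𝓘(ℝ, Euc d →L[ℝ] Euc d) ∞
      (fun q ↦ η q ∘L (trivializationAt (Euc d) (fun q : M ↦ TangentSpace (𝓡 d) q) p).symmL ℝ q)
      p := by
  have h := (hη _ hp).contMDiffAt (hU.mem_nhds hp)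
  rw [contMDiffAt_hom_bundle] at h
  refine h.2.congr_of_eventuallyEq ?_
  have hb := (trivializationAt (Euc d) (fun q : M ↦ TangentSpace (𝓡 d) q) p).open_baseSet.mem_nhds
    (mem_baseSet_trivializationAt (Euc d) (fun q : M ↦ TangentSpace (𝓡 d) q) p)
  filter_upwards [hb] with q hq
  ext1 v
  simp [ContinuousLinearMap.inCoordinates]

variable {P : ∀ p : M, TangentSpace (𝓡 d) p ≃L[ℝ] Euc d} {U : Set M}

/-- The pointwise inverse of a smooth coframe is smooth. -/
theorem IsSmoothOneFormOn.contMDiffAt_symm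
    (hP : IsSmoothOneFormOn (fun p ↦ (P p : TangentSpace (𝓡 d) p →L[ℝ] Euc d)) U)
    (hU : IsOpen U) {p : M} (hp : p ∈ U) :
    ContMDiffAt (𝓡 d) ((𝓡 d).prod 𝓘(ℝ, Euc d →L[ℝ] Euc d)) ∞
      (fun q ↦ TotalSpace.mk' (Euc d →L[ℝ] Euc d)
        (E := fun q : M ↦ (Bundle.Trivial M (Euc d) q →L[ℝ] TangentSpace (𝓡 d) q)) q
        ((P q).symm : Euc d →L[ℝ] TangentSpace (𝓡 d) q)) p := by
  classical
  set e := trivializationAt (Euc d) (fun q : M ↦ TangentSpace (𝓡 d) q) p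
  have hpe : p ∈ e.baseSet :=
    mem_baseSet_trivializationAt (Euc d) (fun q : M ↦ TangentSpace (𝓡 d) q) p
  have h := hP.contMDiffAt_comp_symmL hU hp
  -- `Q` is the matrix of `P` in the trivialization at `p`. The value off the base set only makes it
  -- an equivalence everywhere; near `p` it is never seen. Smoothness of inversion at the invertible
  -- map `Q p` does the rest.
  let Q : M → (Euc d ≃L[ℝ] Euc d) := fun q ↦
    if hq : q ∈ e.baseSet then (e.continuousLinearEquivAt ℝ q hq).symm.trans (P q)
    else ContinuousLinearEquiv.refl ℝ (Euc d)
  have hQ : ContMDiffAt (𝓡 d) 𝓘(ℝ, Euc d →L[ℝ] Euc d) ∞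
      (fun q ↦ ((Q q : Euc d ≃L[ℝ] Euc d) : Euc d →L[ℝ] Euc d)) p := by
    refine h.congr_of_eventuallyEq ?_
    filter_upwards [e.open_baseSet.mem_nhds hpe] with q hq
    ext1 v
    simp only [Q, dif_pos hq]
    exact congrArg (P q)
      (congrFun (e.symm_continuousLinearEquivAt_eq (R := ℝ) hq) v)
  have hinv : ContMDiffAt (𝓡 d) 𝓘(ℝ, Euc d →L[ℝ] Euc d) ∞
      (fun q ↦ ContinuousLinearMap.inverse ((Q q : Euc d ≃L[ℝ] Euc d) : Euc d →L[ℝ] Euc d)) p := by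
    have := (contDiffAt_map_inverse (𝕜 := ℝ) (n := ∞) (Q p)).contMDiffAt
    exact this.comp p hQ
  rw [contMDiffAt_hom_bundle]
  refine ⟨contMDiffAt_id, hinv.congr_of_eventuallyEq ?_⟩
  filter_upwards [e.open_baseSet.mem_nhds hpe] with q hq
  rw [ContinuousLinearMap.inverse_equiv]
  ext1 v
  simp only [Q, dif_pos hq]
  rw [ContinuousLinearMap.inCoordinates_eq (mem_univ _) hq]
  simp [e, ContinuousLinearEquiv.symm_trans_apply]

end Coframes

/-- The product rule for the inner product of two vector-valued functions. -/
theorem mvfderiv_inner_apply {d : ℕ} {M : Type*} [TopologicalSpace M] [ChartedSpace (Euc d) M]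
    {f g : M → Euc d} {p : M} (hf : MDifferentiableAt (𝓡 d) 𝓘(ℝ, Euc d) f p)
    (hg : MDifferentiableAt (𝓡 d) 𝓘(ℝ, Euc d) g p) (X : TangentSpace (𝓡 d) p) :
    mvfderiv (𝓡 d) (fun q ↦ inner ℝ (f q) (g q)) p X =
      inner ℝ (mvfderiv (𝓡 d) f p X) (g p) + inner ℝ (f p) (mvfderiv (𝓡 d) g p X) := by
  have h1 := hf.hasMFDerivAt
  have h2 := hg.hasMFDerivAt
  have h3 : HasMFDerivAt (𝓡 d) 𝓘(ℝ, ℝ) (fun q ↦ inner ℝ (f q) (g q)) p _ :=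
    ⟨ContinuousAt.inner h1.1 h2.1, h1.2.inner ℝ h2.2⟩
  refine (congrArg (fun L ↦ L X) h3.mfderiv).trans ?_
  simp only [writtenInExtChartAt, Function.comp_apply, extChartAt_to_inv]
  exact add_comm _ _

/-! ### The connection of a coframe -/

section CoframeConnection

variable {d : ℕ} {M : Type*} [TopologicalSpace M] [ChartedSpace (Euc d) M]

/-- The covariant derivative `P⁻¹ d(P σ)`, for which the coframe `P` is parallel. -/
def coframeDeriv (P : ∀ p : M, TangentSpace (𝓡 d) p ≃L[ℝ] Euc d)
    (σ : ∀ p : M, TangentSpace (𝓡 d) p) (p : M) :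
    TangentSpace (𝓡 d) p →L[ℝ] TangentSpace (𝓡 d) p :=
  ((P p).symm : Euc d →L[ℝ] TangentSpace (𝓡 d) p) ∘L
    mvfderiv (𝓡 d) (fun q ↦ P q (σ q)) p

variable {P : ∀ p : M, TangentSpace (𝓡 d) p ≃L[ℝ] Euc d} {U : Set M}

theorem apply_coframeDeriv (σ : ∀ p : M, TangentSpace (𝓡 d) p) (p : M)
    (X : TangentSpace (𝓡 d) p) :
    P p (coframeDeriv P σ p X) = mvfderiv (𝓡 d) (fun q ↦ P q (σ q)) p X :=
  (P p).apply_symm_apply _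

variable [IsManifold (𝓡 d) ∞ M]

/-- After applying the injective map `P p`, both axioms are the sum and product rules for the
derivative of the coordinates `P σ`. -/
theorem IsSmoothOneFormOn.isCovariantDerivativeOn_coframeDeriv
    (hP : IsSmoothOneFormOn (fun p ↦ (P p : TangentSpace (𝓡 d) p →L[ℝ] Euc d)) U)
    (hU : IsOpen U) : IsCovariantDerivativeOn (Euc d) (coframeDeriv P) U where
  add {σ σ' p} hσ hσ' hp := by
    ext1 X
    apply (P p).injective
    have h1 := hP.mdifferentiableAt_apply hU hp hσ
    have h2 := hP.mdifferentiableAt_apply hU hp hσ'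
    have h3 : (fun q ↦ P q ((σ + σ') q)) = fun q ↦ P q (σ q) + P q (σ' q) := by
      ext1 q; exact map_add _ _ _
    have h4 := congrArg (fun L ↦ L X) (mvfderiv_fun_add h1 h2)
    refine (apply_coframeDeriv _ _ _).trans ?_
    rw [h3]
    refine h4.trans ?_
    refine Eq.trans ?_ (map_add (P p) _ _).symm
    exact congrArg₂ (· + ·) (apply_coframeDeriv σ p X).symm (apply_coframeDeriv σ' p X).symm
  leibniz {σ g p} hσ hg hp := by
    ext1 X
    apply (P p).injective
    have h1 := hP.mdifferentiableAt_apply hU hp hσ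
    have h3 : (fun q ↦ P q ((g • σ) q)) = fun q ↦ g q • P q (σ q) := by
      ext1 q; exact (P q).map_smul (g q) (σ q)
    have h4 := congrArg (fun L ↦ L X) (mvfderiv_fun_smul hg h1)
    refine (apply_coframeDeriv _ _ _).trans ?_
    rw [h3]
    refine h4.trans ?_
    refine Eq.trans ?_ (map_add (P p) _ _).symm
    simp [apply_coframeDeriv]

/-- The connection of a closed coframe has no torsion. -/
theorem IsClosedOneFormOn.coframeDeriv_sub
    (hc : IsClosedOneFormOn (fun p ↦ (P p : TangentSpace (𝓡 d) p →L[ℝ] Euc d)) U)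
    {X Y : ∀ p : M, TangentSpace (𝓡 d) p} {p : M} (hp : p ∈ U)
    (hX : MDifferentiableAt (𝓡 d) (𝓡 d).tangent (fun q ↦ (⟨q, X q⟩ : TangentBundle (𝓡 d) M)) p)
    (hY : MDifferentiableAt (𝓡 d) (𝓡 d).tangent
      (fun q ↦ (⟨q, Y q⟩ : TangentBundle (𝓡 d) M)) p) :
    coframeDeriv P Y p (X p) - coframeDeriv P X p (Y p) = VectorField.mlieBracket (𝓡 d) X Y p := by
  apply (P p).injective
  rw [map_sub, apply_coframeDeriv, apply_coframeDeriv]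
  exact sub_eq_zero.1 (hc p hp X Y hX hY)

/-- The connection of a coframe is compatible with the pullback of the inner product. -/
theorem IsSmoothOneFormOn.mvfderiv_inner
    (hP : IsSmoothOneFormOn (fun p ↦ (P p : TangentSpace (𝓡 d) p →L[ℝ] Euc d)) U)
    (hU : IsOpen U) {σ τ : ∀ p : M, TangentSpace (𝓡 d) p} {p : M} (hp : p ∈ U)
    (hσ : MDifferentiableAt (𝓡 d) (𝓡 d).tangent (fun q ↦ (⟨q, σ q⟩ : TangentBundle (𝓡 d) M)) p)
    (hτ : MDifferentiableAt (𝓡 d) (𝓡 d).tangent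
      (fun q ↦ (⟨q, τ q⟩ : TangentBundle (𝓡 d) M)) p) (X : TangentSpace (𝓡 d) p) :
    mvfderiv (𝓡 d) (fun q ↦ inner ℝ (P q (σ q)) (P q (τ q))) p X =
      inner ℝ (P p (coframeDeriv P σ p X)) (P p (τ p))
        + inner ℝ (P p (σ p)) (P p (coframeDeriv P τ p X)) := by
  rw [apply_coframeDeriv, apply_coframeDeriv]
  exact mvfderiv_inner_apply (hP.mdifferentiableAt_apply hU hp hσ)
    (hP.mdifferentiableAt_apply hU hp hτ) X

end CoframeConnection

/-! ### Local uniqueness of the Levi-Civita connection -/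

section LeviCivita

variable {d : ℕ} {M : Type*} [TopologicalSpace M] [ChartedSpace (Euc d) M]

theorem Filter.EventuallyEq.mvfderiv_eq {F : Type*} [NormedAddCommGroup F] [NormedSpace ℝ F]
    {f g : M → F} {p : M} (h : f =ᶠ[𝓝 p] g) : mvfderiv (𝓡 d) f p = mvfderiv (𝓡 d) g p := by
  have h1 := h.mfderiv_eq (I := 𝓡 d) (I' := 𝓘(ℝ, F))
  ext X
  exact congrArg (fun L ↦ L X) h1

variable [IsManifold (𝓡 d) ∞ M]
  {g : ContMDiffRiemannianMetric (𝓡 d) ∞ (Euc d) (fun p : M ↦ TangentSpace (𝓡 d) p)}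
  {cov : CovariantDerivative (𝓡 d) (Euc d) (fun p : M ↦ TangentSpace (𝓡 d) p)}

/-- Trades the Riemannian bundle instance hidden in `IsLeviCivita` for explicit identities in
`g.inner`. -/
theorem isLeviCivita_iff : IsLeviCivita g cov ↔
    (∀ {X Y : ∀ p : M, TangentSpace (𝓡 d) p} {p : M},
      MDifferentiableAt (𝓡 d) (𝓡 d).tangent (fun q ↦ (⟨q, X q⟩ : TangentBundle (𝓡 d) M)) p →
      MDifferentiableAt (𝓡 d) (𝓡 d).tangent (fun q ↦ (⟨q, Y q⟩ : TangentBundle (𝓡 d) M)) p →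
      cov Y p (X p) - cov X p (Y p) = VectorField.mlieBracket (𝓡 d) X Y p) ∧
    ∀ {p : M} {X σ τ : ∀ p : M, TangentSpace (𝓡 d) p},
      MDifferentiableAt (𝓡 d) (𝓡 d).tangent (fun q ↦ (⟨q, X q⟩ : TangentBundle (𝓡 d) M)) p →
      MDifferentiableAt (𝓡 d) (𝓡 d).tangent (fun q ↦ (⟨q, σ q⟩ : TangentBundle (𝓡 d) M)) p →
      MDifferentiableAt (𝓡 d) (𝓡 d).tangent (fun q ↦ (⟨q, τ q⟩ : TangentBundle (𝓡 d) M)) p →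
      mvfderiv (𝓡 d) (fun q ↦ g.inner q (σ q) (τ q)) p (X p) =
        g.inner p (cov σ p (X p)) (τ p) + g.inner p (σ p) (cov τ p (X p)) := by
  let _ : RiemannianBundle (fun p : M ↦ TangentSpace (𝓡 d) p) := ⟨g.toRiemannianMetric⟩
  exact and_congr cov.torsion_eq_zero_iff cov.isMetricCompatible_iff

variable {P : ∀ p : M, TangentSpace (𝓡 d) p ≃L[ℝ] Euc d} {U : Set M}

/-- The Levi-Civita connection of a metric which is the pullback of the inner product of `ℝ^d` by a
closed coframe `P` is the connection for which `P` is parallel. -/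
theorem IsLeviCivita.eq_coframeDeriv (hcov : IsLeviCivita g cov)
    (hP : IsSmoothOneFormOn (fun p ↦ (P p : TangentSpace (𝓡 d) p →L[ℝ] Euc d)) U)
    (hc : IsClosedOneFormOn (fun p ↦ (P p : TangentSpace (𝓡 d) p →L[ℝ] Euc d)) U)
    (hU : IsOpen U)
    (hg : ∀ p ∈ U, ∀ X Y, g.inner p X Y = inner ℝ (P p X) (P p Y))
    {σ : ∀ p : M, TangentSpace (𝓡 d) p} {p : M} (hp : p ∈ U)
    (hσ : MDifferentiableAt (𝓡 d) (𝓡 d).tangent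
      (fun q ↦ (⟨q, σ q⟩ : TangentBundle (𝓡 d) M)) p) :
    cov σ p = coframeDeriv P σ p := by
  obtain ⟨htor, hmet⟩ := isLeviCivita_iff.1 hcov
  -- The difference of the two connections at `p`, with its value paired with `Z` in the metric.
  -- Vanishing torsion makes it symmetric in `X, Y`; metric compatibility makes it skew in `Y, Z`.
  let D (X Y Z : ∀ p : M, TangentSpace (𝓡 d) p) : ℝ :=
    inner ℝ (P p (cov Y p (X p) - coframeDeriv P Y p (X p))) (P p (Z p))
  have hsymm : ∀ {X Y Z : ∀ p : M, TangentSpace (𝓡 d) p},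
      MDifferentiableAt (𝓡 d) (𝓡 d).tangent (fun q ↦ (⟨q, X q⟩ : TangentBundle (𝓡 d) M)) p →
      MDifferentiableAt (𝓡 d) (𝓡 d).tangent (fun q ↦ (⟨q, Y q⟩ : TangentBundle (𝓡 d) M)) p →
      D X Y Z = D Y X Z := fun {X Y Z} hX hY ↦ by
    have h : cov Y p (X p) - coframeDeriv P Y p (X p) =
        cov X p (Y p) - coframeDeriv P X p (Y p) := by
      have h1 := htor hX hY
      rw [← hc.coframeDeriv_sub hp hX hY, sub_eq_sub_iff_sub_eq_sub] at h1
      exact h1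
    simp only [D]
    rw [h]
  have hanti : ∀ {X Y Z : ∀ p : M, TangentSpace (𝓡 d) p},
      MDifferentiableAt (𝓡 d) (𝓡 d).tangent (fun q ↦ (⟨q, X q⟩ : TangentBundle (𝓡 d) M)) p →
      MDifferentiableAt (𝓡 d) (𝓡 d).tangent (fun q ↦ (⟨q, Y q⟩ : TangentBundle (𝓡 d) M)) p →
      MDifferentiableAt (𝓡 d) (𝓡 d).tangent (fun q ↦ (⟨q, Z q⟩ : TangentBundle (𝓡 d) M)) p →
      D X Y Z = -D X Z Y := fun {X Y Z} hX hY hZ ↦ by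
    have h1 := hmet hX hY hZ
    have h2 := hP.mvfderiv_inner hU hp hY hZ (X p)
    have h3 : (fun q ↦ g.inner q (Y q) (Z q)) =ᶠ[𝓝 p]
        fun q ↦ inner ℝ (P q (Y q)) (P q (Z q)) := by
      filter_upwards [hU.mem_nhds hp] with q hq using hg q hq _ _
    rw [h3.mvfderiv_eq, h2, hg p hp, hg p hp] at h1
    simp only [D, map_sub, inner_sub_left]
    rw [real_inner_comm (P p (Y p)), real_inner_comm (P p (Y p))]
    linarith
  ext1 x
  refine sub_eq_zero.1 ((P p).injective ?_)
  rw [map_zero, ← inner_self_eq_zero (𝕜 := ℝ)]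
  -- The symmetries of `D` concern fields, so vectors at `p` are extended. With `Z` the difference
  -- vector itself, `D X σ Z` is the squared norm of its image under `P p`.
  let X := FiberBundle.extend (Euc d) (E := fun p : M ↦ TangentSpace (𝓡 d) p) x
  let Z := FiberBundle.extend (Euc d) (E := fun p : M ↦ TangentSpace (𝓡 d) p)
    (cov σ p x - coframeDeriv P σ p x)
  have hX : MDifferentiableAt (𝓡 d) (𝓡 d).tangent
      (fun q ↦ (⟨q, X q⟩ : TangentBundle (𝓡 d) M)) p :=
    FiberBundle.mdifferentiableAt_extend (𝓡 d) (Euc d) _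
  have hZ : MDifferentiableAt (𝓡 d) (𝓡 d).tangent
      (fun q ↦ (⟨q, Z q⟩ : TangentBundle (𝓡 d) M)) p :=
    FiberBundle.mdifferentiableAt_extend (𝓡 d) (Euc d) _
  have hX' : X p = x := FiberBundle.extend_apply_self _ _
  have hZ' : Z p = cov σ p x - coframeDeriv P σ p x := FiberBundle.extend_apply_self _ _
  have h0 : D X σ Z = 0 := by
    -- Alternating the skew and symmetric exchanges runs through all six orders of `X, σ, Z` and
    -- returns with three sign changes: `D X σ Z = -D X σ Z`.
    have e1 := hanti hX hσ hZ
    have e2 := hsymm (Z := σ) hX hZ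
    have e3 := hanti hZ hX hσ
    have e4 := hsymm (Z := X) hZ hσ
    have e5 := hanti hσ hZ hX
    have e6 := hsymm (Z := Z) hσ hX
    linarith
  simpa only [D, hX', hZ'] using h0

end LeviCivita

/-! ### Commutation of second derivatives up to the Lie bracket -/

section SecondDerivatives

/-- Being `C^∞` at a point provides for each finite order its own neighbourhood, not one for all
orders. Order one suffices for first-order identities to hold near `p`, so that they may be
differentiated again. -/
theorem ContMDiffAt.eventually_one {E H M E' H' M' : Type*} [NormedAddCommGroup E]
    [NormedSpace ℝ E] [TopologicalSpace H] {I : ModelWithCorners ℝ E H} [TopologicalSpace M]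
    [ChartedSpace H M] [NormedAddCommGroup E'] [NormedSpace ℝ E'] [TopologicalSpace H']
    {I' : ModelWithCorners ℝ E' H'} [TopologicalSpace M'] [ChartedSpace H' M'] [IsManifold I 1 M]
    [IsManifold I' 1 M'] {f : M → M'} {p : M} (hf : ContMDiffAt I I' ∞ f p) :
    ∀ᶠ q in 𝓝 p, ContMDiffAt I I' 1 f q :=
  contMDiffAt_iff_contMDiffAt_nhds (by simp) |>.1 (hf.of_le (by simp))

variable {d : ℕ} {M : Type*} [TopologicalSpace M] [ChartedSpace (Euc d) M]
  [IsManifold (𝓡 d) ∞ M]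

/-- The differential of a smooth function is a smooth section of the cotangent bundle. -/
theorem ContMDiffAt.mvfderiv_section {F : Type*} [NormedAddCommGroup F] [NormedSpace ℝ F]
    {f : M → F} {p : M} (hf : ContMDiffAt (𝓡 d) 𝓘(ℝ, F) ∞ f p) :
    ContMDiffAt (𝓡 d) ((𝓡 d).prod 𝓘(ℝ, Euc d →L[ℝ] F)) ∞
      (fun q ↦ TotalSpace.mk' (Euc d →L[ℝ] F)
        (E := fun q : M ↦ (TangentSpace (𝓡 d) q →L[ℝ] Bundle.Trivial M F q)) q
        (mvfderiv (𝓡 d) f q)) p := by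
  rw [contMDiffAt_hom_bundle]
  refine ⟨contMDiffAt_id, (hf.mfderiv_const (m := ∞) (by simp)).congr_of_eventuallyEq ?_⟩
  have hb := (trivializationAt (Euc d) (fun q : M ↦ TangentSpace (𝓡 d) q) p).open_baseSet.mem_nhds
    (mem_baseSet_trivializationAt (Euc d) (fun q : M ↦ TangentSpace (𝓡 d) q) p)
  filter_upwards [hb] with q hq
  ext1 v
  simp [inTangentCoordinates, ContinuousLinearMap.inCoordinates, TangentBundle.continuousLinearMapAt_model_space]
  rfl

theorem ContMDiffAt.mvfderiv_apply {F : Type*} [NormedAddCommGroup F] [NormedSpace ℝ F]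
    {f : M → F} {p : M} (hf : ContMDiffAt (𝓡 d) 𝓘(ℝ, F) ∞ f p)
    {X : ∀ p : M, TangentSpace (𝓡 d) p}
    (hX : ContMDiffAt (𝓡 d) (𝓡 d).tangent ∞ (fun q ↦ (⟨q, X q⟩ : TangentBundle (𝓡 d) M)) p) :
    ContMDiffAt (𝓡 d) 𝓘(ℝ, F) ∞ (fun q ↦ mvfderiv (𝓡 d) f q (X q)) p := by
  have h3 := ContMDiffAt.clm_bundle_apply (E₁ := fun p : M ↦ TangentSpace (𝓡 d) p)
    (E₂ := Bundle.Trivial M F) (ϕ := fun y ↦ mvfderiv (𝓡 d) f y) (v := X) hf.mvfderiv_section hX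
  exact (contMDiffAt_totalSpace.1 h3).2

/-- The Lie bracket applied twice to the product of a function and a vector field. -/
theorem mlieBracket_mlieBracket_smul {f : M → ℝ} {p : M}
    {X Y V : ∀ p : M, TangentSpace (𝓡 d) p} (hf : ContMDiffAt (𝓡 d) 𝓘(ℝ, ℝ) ∞ f p)
    (hY : ContMDiffAt (𝓡 d) (𝓡 d).tangent ∞ (fun q ↦ (⟨q, Y q⟩ : TangentBundle (𝓡 d) M)) p)
    (hV : ContMDiffAt (𝓡 d) (𝓡 d).tangent ∞ (fun q ↦ (⟨q, V q⟩ : TangentBundle (𝓡 d) M)) p) :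
    VectorField.mlieBracket (𝓡 d) X (VectorField.mlieBracket (𝓡 d) Y (f • V)) p =
      (mvfderiv (𝓡 d) (fun q ↦ mvfderiv (𝓡 d) f q (Y q)) p (X p) • V p
        + mvfderiv (𝓡 d) f p (Y p) • VectorField.mlieBracket (𝓡 d) X V p)
      + (mvfderiv (𝓡 d) f p (X p) • VectorField.mlieBracket (𝓡 d) Y V p
        + f p • VectorField.mlieBracket (𝓡 d) X (VectorField.mlieBracket (𝓡 d) Y V) p) := by
  have : IsManifold (𝓡 d) (minSmoothness ℝ 2) M :=
    IsManifold.of_le (n := ∞) (by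
      rw [minSmoothness_of_isRCLikeNormedField]; exact ENat.LEInfty.out)
  have : IsManifold (𝓡 d) ((2 : ℕ∞) + 1) M :=
    IsManifold.of_le (n := ∞) (mod_cast (le_top : (3 : ℕ∞) ≤ ⊤))
  have h2 : ((2 : ℕ∞) : WithTop ℕ∞) ≤ ∞ := mod_cast (le_top : (2 : ℕ∞) ≤ ⊤)
  have hev : VectorField.mlieBracket (𝓡 d) Y (f • V) =ᶠ[𝓝 p]
      (fun q ↦ mvfderiv (𝓡 d) f q (Y q)) • V + f • VectorField.mlieBracket (𝓡 d) Y V := by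
    filter_upwards [hf.eventually_one,
      hV.eventually_one] with q h1 h2
    exact VectorField.mlieBracket_smul_right (h1.mdifferentiableAt (by simp))
      (h2.mdifferentiableAt (by simp))
  have hYf := (hf.mvfderiv_apply hY).mdifferentiableAt (by simp)
  have hV' := hV.mdifferentiableAt (by simp)
  have hf' := hf.mdifferentiableAt (by simp)
  have hYV : MDifferentiableAt (𝓡 d) (𝓡 d).tangent
      (fun q ↦ (⟨q, VectorField.mlieBracket (𝓡 d) Y V q⟩ : TangentBundle (𝓡 d) M)) p :=
    (ContMDiffAt.mlieBracket_vectorField (m := 1) (n := 2) (hY.of_le h2) (hV.of_le h2)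
      (by norm_num [minSmoothness_of_isRCLikeNormedField, one_add_one_eq_two])).mdifferentiableAt
      (by simp)
  rw [(Filter.EventuallyEq.refl _ X).mlieBracket_vectorField_eq hev,
    VectorField.mlieBracket_add_right (hYf.smul_section hV') (hf'.smul_section hYV),
    VectorField.mlieBracket_smul_right hYf hV', VectorField.mlieBracket_smul_right hf' hYV]

/-- Second derivatives of a function commute up to the Lie bracket. -/
theorem mvfderiv_mlieBracket_smul {f : M → ℝ} {p : M}
    {X Y V : ∀ p : M, TangentSpace (𝓡 d) p} (hf : ContMDiffAt (𝓡 d) 𝓘(ℝ, ℝ) ∞ f p)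
    (hX : ContMDiffAt (𝓡 d) (𝓡 d).tangent ∞ (fun q ↦ (⟨q, X q⟩ : TangentBundle (𝓡 d) M)) p)
    (hY : ContMDiffAt (𝓡 d) (𝓡 d).tangent ∞ (fun q ↦ (⟨q, Y q⟩ : TangentBundle (𝓡 d) M)) p)
    (hV : ContMDiffAt (𝓡 d) (𝓡 d).tangent ∞ (fun q ↦ (⟨q, V q⟩ : TangentBundle (𝓡 d) M)) p) :
    (mvfderiv (𝓡 d) (fun q ↦ mvfderiv (𝓡 d) f q (Y q)) p (X p)
      - mvfderiv (𝓡 d) (fun q ↦ mvfderiv (𝓡 d) f q (X q)) p (Y p)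
      - mvfderiv (𝓡 d) f p (VectorField.mlieBracket (𝓡 d) X Y p)) • V p = 0 := by
  have hle : minSmoothness ℝ 2 ≤ ∞ := by
      rw [minSmoothness_of_isRCLikeNormedField]; exact ENat.LEInfty.out
  have : IsManifold (𝓡 d) (minSmoothness ℝ 3) M :=
    IsManifold.of_le (n := ∞) (by
      rw [minSmoothness_of_isRCLikeNormedField]; exact ENat.LEInfty.out)
  have hfV : ContMDiffAt (𝓡 d) (𝓡 d).tangent ∞
      (fun q ↦ (⟨q, (f • V) q⟩ : TangentBundle (𝓡 d) M)) p := hf.smul_section hV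
  -- The Jacobi identity for `X, Y, f V` minus `f` times the one for `X, Y, V`: the terms with one
  -- derivative of `f` next to a bracket with `V` cancel, and only the commutator of derivatives of
  -- `f`, times `V`, remains.
  have h1 := VectorField.leibniz_identity_mlieBracket_apply (hX.of_le hle) (hY.of_le hle)
    (hfV.of_le hle)
  have h2 := VectorField.leibniz_identity_mlieBracket_apply (hX.of_le hle) (hY.of_le hle)
    (hV.of_le hle)
  rw [mlieBracket_mlieBracket_smul hf hY hV, mlieBracket_mlieBracket_smul hf hX hV,
    VectorField.mlieBracket_smul_right (hf.mdifferentiableAt (by simp))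
      (hV.mdifferentiableAt (by simp)), h2] at h1
  rw [sub_smul, sub_smul]
  rw [smul_add] at h1
  rw [← sub_eq_zero] at h1 ⊢
  refine Eq.trans ?_ h1
  module

/-- Argued component by component from the scalar case, with an auxiliary field `V` that does not
vanish at `p`. -/
theorem mvfderiv_mlieBracket {f : M → Euc d} {p : M}
    {X Y : ∀ p : M, TangentSpace (𝓡 d) p} (hf : ContMDiffAt (𝓡 d) 𝓘(ℝ, Euc d) ∞ f p)
    (hX : ContMDiffAt (𝓡 d) (𝓡 d).tangent ∞ (fun q ↦ (⟨q, X q⟩ : TangentBundle (𝓡 d) M)) p)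
    (hY : ContMDiffAt (𝓡 d) (𝓡 d).tangent ∞ (fun q ↦ (⟨q, Y q⟩ : TangentBundle (𝓡 d) M)) p) :
    mvfderiv (𝓡 d) (fun q ↦ mvfderiv (𝓡 d) f q (Y q)) p (X p)
      - mvfderiv (𝓡 d) (fun q ↦ mvfderiv (𝓡 d) f q (X q)) p (Y p)
      - mvfderiv (𝓡 d) f p (VectorField.mlieBracket (𝓡 d) X Y p) = 0 := by
  have hcomp : ∀ {h : M → Euc d} {q : M} (_ : ContMDiffAt (𝓡 d) 𝓘(ℝ, Euc d) 1 h q)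
      (k : Fin d) (Z : TangentSpace (𝓡 d) q),
      mvfderiv (𝓡 d) (fun r ↦ h r k) q Z = mvfderiv (𝓡 d) h q Z k := by
    intro h q hh k Z
    have h1 := (EuclideanSpace.proj (𝕜 := ℝ) k).hasMFDerivAt (x := h q)
    exact congrArg (fun L ↦ L Z)
      (h1.comp q (hh.mdifferentiableAt (by simp)).hasMFDerivAt).mfderiv
  have hfk : ∀ k, ContMDiffAt (𝓡 d) 𝓘(ℝ, ℝ) ∞ (fun q ↦ f q k) p := fun k ↦
    (EuclideanSpace.proj (𝕜 := ℝ) k).contMDiff.contMDiffAt.comp p hf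
  have hev : ∀ (k) (Z : ∀ p : M, TangentSpace (𝓡 d) p),
      (fun q ↦ mvfderiv (𝓡 d) (fun r ↦ f r k) q (Z q)) =ᶠ[𝓝 p]
      fun q ↦ mvfderiv (𝓡 d) f q (Z q) k := fun k Z ↦ by
    filter_upwards [hf.eventually_one] with q hq
    exact hcomp hq k _
  ext k
  -- The index `k` of the component also supplies `V`, an extension of the basis vector `e_k`, so
  -- dimension zero needs no separate case.
  have h := mvfderiv_mlieBracket_smul (hfk k) hX hY
    (FiberBundle.contMDiffAt_extend (𝓡 d) (Euc d)
      (show TangentSpace (𝓡 d) p from EuclideanSpace.single k (1 : ℝ)))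
  rw [FiberBundle.extend_apply_self, (hev k Y).mvfderiv_eq, (hev k X).mvfderiv_eq,
    hcomp ((hf.mvfderiv_apply hY).of_le (by simp)), hcomp ((hf.mvfderiv_apply hX).of_le (by simp)),
    hcomp (hf.of_le (by simp))] at h
  refine (smul_eq_zero.1 h).resolve_right ?_
  intro h0
  have h1 := congrArg (fun v : Euc d ↦ v k) h0
  refine one_ne_zero (α := ℝ) (Eq.trans ?_ h1)
  show (1 : ℝ) = (EuclideanSpace.single k (1 : ℝ) : Euc d) k
  simp

end SecondDerivatives

/-! ### Smoothness and vanishing curvature -/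

section Flat

variable {d : ℕ} {M : Type*} [TopologicalSpace M] [ChartedSpace (Euc d) M]
  [IsManifold (𝓡 d) ∞ M]
  {P : ∀ p : M, TangentSpace (𝓡 d) p ≃L[ℝ] Euc d} {U : Set M}

theorem IsSmoothOneFormOn.contMDiffAt_symm_apply
    (hP : IsSmoothOneFormOn (fun p ↦ (P p : TangentSpace (𝓡 d) p →L[ℝ] Euc d)) U)
    (hU : IsOpen U) {p : M} (hp : p ∈ U) {f : M → Euc d}
    (hf : ContMDiffAt (𝓡 d) 𝓘(ℝ, Euc d) ∞ f p) :
    ContMDiffAt (𝓡 d) (𝓡 d).tangent ∞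
      (fun q ↦ (⟨q, (P q).symm (f q)⟩ : TangentBundle (𝓡 d) M)) p := by
  have hf' : ContMDiffAt (𝓡 d) ((𝓡 d).prod 𝓘(ℝ, Euc d)) ∞
      (fun q ↦ TotalSpace.mk' (Euc d) (E := Bundle.Trivial M (Euc d)) q (f q)) p :=
    contMDiffAt_totalSpace.2 ⟨contMDiffAt_id, hf⟩
  exact ContMDiffAt.clm_bundle_apply (E₁ := Bundle.Trivial M (Euc d))
    (E₂ := fun p : M ↦ TangentSpace (𝓡 d) p)
    (ϕ := fun q ↦ ((P q).symm : Euc d →L[ℝ] TangentSpace (𝓡 d) q)) (v := f)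
    (hP.contMDiffAt_symm hU hp) hf'

/-- The covariant derivative defined by a smooth coframe is smooth. -/
theorem IsSmoothOneFormOn.contMDiffAt_coframeDeriv
    (hP : IsSmoothOneFormOn (fun p ↦ (P p : TangentSpace (𝓡 d) p →L[ℝ] Euc d)) U)
    (hU : IsOpen U) {p : M} (hp : p ∈ U) {σ : ∀ p : M, TangentSpace (𝓡 d) p}
    (hσ : ContMDiffAt (𝓡 d) (𝓡 d).tangent ∞ (fun q ↦ (⟨q, σ q⟩ : TangentBundle (𝓡 d) M)) p) :
    ContMDiffAt (𝓡 d) ((𝓡 d).prod 𝓘(ℝ, Euc d →L[ℝ] Euc d)) ∞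
      (fun q ↦ TotalSpace.mk' (Euc d →L[ℝ] Euc d)
        (E := fun q : M ↦ (TangentSpace (𝓡 d) q →L[ℝ] TangentSpace (𝓡 d) q)) q
        (coframeDeriv P σ q)) p := by
  have h1 := hP.contMDiffAt_symm hU hp
  have h2 := (hP.contMDiffAt_apply hU le_rfl hp hσ).mvfderiv_section
  rw [contMDiffAt_hom_bundle] at h1 h2 ⊢
  refine ⟨contMDiffAt_id, (h1.2.clm_comp h2.2).congr_of_eventuallyEq ?_⟩
  have hb := (trivializationAt (Euc d) (fun q : M ↦ TangentSpace (𝓡 d) q) p).open_baseSet.mem_nhds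
    (mem_baseSet_trivializationAt (Euc d) (fun q : M ↦ TangentSpace (𝓡 d) q) p)
  filter_upwards [hb] with q hq
  ext1 v
  simp [ContinuousLinearMap.inCoordinates]
  rfl

variable {g : ContMDiffRiemannianMetric (𝓡 d) ∞ (Euc d) (fun p : M ↦ TangentSpace (𝓡 d) p)}
  {cov : CovariantDerivative (𝓡 d) (Euc d) (fun p : M ↦ TangentSpace (𝓡 d) p)}

/-- A connection agreeing on `U` with the one defined by a coframe. -/
def IsFlatWith (cov : CovariantDerivative (𝓡 d) (Euc d) (fun p : M ↦ TangentSpace (𝓡 d) p))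
    (P : ∀ p : M, TangentSpace (𝓡 d) p ≃L[ℝ] Euc d) (U : Set M) : Prop :=
  ∀ p ∈ U, ∀ σ : ∀ p : M, TangentSpace (𝓡 d) p,
    MDifferentiableAt (𝓡 d) (𝓡 d).tangent (fun q ↦ (⟨q, σ q⟩ : TangentBundle (𝓡 d) M)) p →
    cov σ p = coframeDeriv P σ p

theorem IsFlatWith.eventually_eq (h : IsFlatWith cov P U) (hU : IsOpen U) {p : M} (hp : p ∈ U)
    {σ : ∀ p : M, TangentSpace (𝓡 d) p}
    (hσ : ContMDiffAt (𝓡 d) (𝓡 d).tangent ∞ (fun q ↦ (⟨q, σ q⟩ : TangentBundle (𝓡 d) M)) p) :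
    ∀ᶠ q in 𝓝 p, cov σ q = coframeDeriv P σ q := by
  filter_upwards [hU.mem_nhds hp, hσ.eventually_one] with q hq h1
  exact h q hq σ (h1.mdifferentiableAt (by simp))

theorem IsFlatWith.contMDiffAt (h : IsFlatWith cov P U)
    (hP : IsSmoothOneFormOn (fun p ↦ (P p : TangentSpace (𝓡 d) p →L[ℝ] Euc d)) U)
    (hU : IsOpen U) {p : M} (hp : p ∈ U) {σ : ∀ p : M, TangentSpace (𝓡 d) p}
    (hσ : ContMDiffAt (𝓡 d) (𝓡 d).tangent ∞ (fun q ↦ (⟨q, σ q⟩ : TangentBundle (𝓡 d) M)) p) :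
    ContMDiffAt (𝓡 d) ((𝓡 d).prod 𝓘(ℝ, Euc d →L[ℝ] Euc d)) ∞
      (fun q ↦ TotalSpace.mk' (Euc d →L[ℝ] Euc d)
        (E := fun q : M ↦ (TangentSpace (𝓡 d) q →L[ℝ] TangentSpace (𝓡 d) q)) q
        (cov σ q)) p := by
  refine (hP.contMDiffAt_coframeDeriv hU hp hσ).congr_of_eventuallyEq ?_
  filter_upwards [h.eventually_eq hU hp hσ] with q hq
  rw [hq]

/-- Under `P` the connection becomes the derivative of the function `P Z`, and the curvature becomes
the defect of commutation of its second derivatives. -/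
theorem IsFlatWith.curvature_eq_zero (h : IsFlatWith cov P U)
    (hP : IsSmoothOneFormOn (fun p ↦ (P p : TangentSpace (𝓡 d) p →L[ℝ] Euc d)) U)
    (hU : IsOpen U) {p : M} (hp : p ∈ U) {X Y Z : ∀ p : M, TangentSpace (𝓡 d) p}
    (hX : ContMDiffAt (𝓡 d) (𝓡 d).tangent ∞ (fun q ↦ (⟨q, X q⟩ : TangentBundle (𝓡 d) M)) p)
    (hY : ContMDiffAt (𝓡 d) (𝓡 d).tangent ∞ (fun q ↦ (⟨q, Y q⟩ : TangentBundle (𝓡 d) M)) p)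
    (hZ : ContMDiffAt (𝓡 d) (𝓡 d).tangent ∞ (fun q ↦ (⟨q, Z q⟩ : TangentBundle (𝓡 d) M)) p) :
    cov (fun q ↦ cov Z q (Y q)) p (X p) - cov (fun q ↦ cov Z q (X q)) p (Y p)
      - cov Z p (VectorField.mlieBracket (𝓡 d) X Y p) = 0 := by
  have hf := hP.contMDiffAt_apply hU le_rfl hp hZ
  have key : ∀ {V : ∀ p : M, TangentSpace (𝓡 d) p} (W : TangentSpace (𝓡 d) p)
      (_ : ContMDiffAt (𝓡 d) (𝓡 d).tangent ∞ (fun q ↦ (⟨q, V q⟩ : TangentBundle (𝓡 d) M)) p),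
      P p (cov (fun q ↦ cov Z q (V q)) p W) =
        mvfderiv (𝓡 d) (fun q ↦ mvfderiv (𝓡 d) (fun r ↦ P r (Z r)) q (V q)) p W := by
    intro V W hV
    have hev := h.eventually_eq hU hp hZ
    -- Agreement with the coframe connection is known only on differentiable sections. Here `∇_V Z`
    -- is one because near `p` it equals `P⁻¹` of the smooth function `d(P Z)(V)`.
    have hs : ContMDiffAt (𝓡 d) (𝓡 d).tangent ∞
        (fun q ↦ (⟨q, cov Z q (V q)⟩ : TangentBundle (𝓡 d) M)) p := by
      refine (hP.contMDiffAt_symm_apply hU hp (hf.mvfderiv_apply hV)).congr_of_eventuallyEq ?_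
      filter_upwards [hev] with q hq
      rw [hq]
      rfl
    rw [h p hp _ (hs.mdifferentiableAt (by simp)), apply_coframeDeriv]
    have hev' : (fun q ↦ P q (cov Z q (V q))) =ᶠ[𝓝 p]
        fun q ↦ mvfderiv (𝓡 d) (fun r ↦ P r (Z r)) q (V q) := by
      filter_upwards [hev] with q hq
      rw [hq, apply_coframeDeriv]
    rw [hev'.mvfderiv_eq]
  apply (P p).injective
  rw [map_sub, map_sub, map_zero, key _ hY, key _ hX, h p hp Z (hZ.mdifferentiableAt (by simp)),
    apply_coframeDeriv]
  exact mvfderiv_mlieBracket hf hX hY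

end Flat

/-! ### Covariant differentiation along a curve in a parallel frame -/

section Transport

variable {d : ℕ} {M : Type*} [TopologicalSpace M] [ChartedSpace (Euc d) M]
  [IsManifold (𝓡 d) ∞ M]
  {P : ∀ p : M, TangentSpace (𝓡 d) p ≃L[ℝ] Euc d} {U : Set M}
  {cov : CovariantDerivative (𝓡 d) (Euc d) (fun p : M ↦ TangentSpace (𝓡 d) p)}

/-- A field along a curve is covariantly differentiable if and only if its coordinates in a parallel
frame are differentiable. -/
theorem IsFlatWith.hasCovDerivAlongAt_iff (h : IsFlatWith cov P U)
    (hP : IsSmoothOneFormOn (fun p ↦ (P p : TangentSpace (𝓡 d) p →L[ℝ] Euc d)) U)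
    (hU : IsOpen U) {γ : ℝ → M} {V : ∀ t : ℝ, TangentSpace (𝓡 d) (γ t)} {t : ℝ} (ht : γ t ∈ U)
    {w : TangentSpace (𝓡 d) (γ t)} :
    HasCovDerivAlongAt cov γ V t w ↔ MDifferentiableAt 𝓘(ℝ, ℝ) (𝓡 d) γ t ∧
      HasDerivAt (fun s ↦ P (γ s) (V s)) (P (γ t) w) t := by
  classical
  refine and_congr_right fun hγ ↦ ?_
  set e := trivializationAt (Euc d) (fun q : M ↦ TangentSpace (𝓡 d) q) (γ t) with he
  have hpe : γ t ∈ e.baseSet :=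
    mem_baseSet_trivializationAt (Euc d) (fun q : M ↦ TangentSpace (𝓡 d) q) (γ t)
  have hbase : ∀ᶠ s in 𝓝 t, γ s ∈ e.baseSet :=
    hγ.continuousAt (e.open_baseSet.mem_nhds hpe)
  -- `Q` is the matrix of `P` in the trivialization at `γ t`. With `c` the coordinates of `V` there,
  -- `P V = Q c`, and the claim is the product rule `(Q c)' = Q' c + Q c'` once `Q' c` is matched
  -- with the connection term.
  let Q : M → (Euc d →L[ℝ] Euc d) := fun q ↦
    (P q : TangentSpace (𝓡 d) q →L[ℝ] Euc d) ∘L e.symmL ℝ q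
  have hQ : MDifferentiableAt (𝓡 d) 𝓘(ℝ, Euc d →L[ℝ] Euc d) Q (γ t) :=
    (hP.contMDiffAt_comp_symmL hU ht).mdifferentiableAt (by simp)
  have hQγ : DifferentiableAt ℝ (fun s ↦ Q (γ s)) t :=
    mdifferentiableAt_iff_differentiableAt.1 (hQ.comp t hγ)
  obtain ⟨Q', hQ'⟩ : ∃ Q', HasDerivAt (fun s ↦ Q (γ s)) Q' t := ⟨_, hQγ.hasDerivAt⟩
  let A : Euc d ≃L[ℝ] Euc d := (e.continuousLinearEquivAt ℝ (γ t) hpe).symm.trans (P (γ t))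
  have hA : Q (γ t) = A := by
    ext1 v
    exact congrArg (P (γ t)) (congrFun (e.symm_continuousLinearEquivAt_eq (R := ℝ) hpe) v).symm
  have hAx : ∀ v, Q (γ t) v = A v := fun v ↦ congrArg (fun L : Euc d →L[ℝ] Euc d ↦ L v) hA
  let c : ℝ → Euc d := fun s ↦ (e ⟨γ s, V s⟩).2
  have hfc : (fun s ↦ P (γ s) (V s)) =ᶠ[𝓝 t] fun s ↦ Q (γ s) (c s) := by
    filter_upwards [hbase] with s hs
    simp [Q, c, e.symmL_apply hs, e.symm_apply_apply_mk hs]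
  set β := cov (FiberBundle.extend (Euc d) (V t)) (γ t)
      (mfderiv 𝓘(ℝ, ℝ) (𝓡 d) γ t (1 : ℝ)) with hβ
  have hew : ∀ u : TangentSpace (𝓡 d) (γ t), A (e ⟨γ t, u⟩).2 = P (γ t) u := fun u ↦
    congrArg (P (γ t)) ((e.continuousLinearEquivAt ℝ (γ t) hpe).symm_apply_apply u)
  -- The extension of `V t` has constant coordinates `c t`, so its image under `P` is `Q (c t)`, and
  -- the covariant derivative differentiates `Q` alone.
  have hext : P (γ t) β = Q' (c t) := by
    have hG : MDifferentiableAt (𝓡 d) 𝓘(ℝ, Euc d) (fun q ↦ Q q (c t)) (γ t) :=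
      hQ.clm_apply mdifferentiableAt_const
    let L : ℝ →L[ℝ] Euc d := (mfderiv (𝓡 d) 𝓘(ℝ, Euc d) (fun q ↦ Q q (c t)) (γ t)).comp
      (mfderiv 𝓘(ℝ, ℝ) (𝓡 d) γ t)
    have hL : HasFDerivAt (fun s ↦ Q (γ s) (c t)) L t :=
      (hG.hasMFDerivAt.comp t hγ.hasMFDerivAt).hasFDerivAt
    have h1 := hL.hasDerivAt
    have h2 := hQ'.clm_apply (hasDerivAt_const t (c t))
    have h3 := h1.unique h2
    rw [map_zero, add_zero] at h3
    rw [← h3, hβ, h _ ht _ (FiberBundle.mdifferentiableAt_extend (𝓡 d) (Euc d) _),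
      apply_coframeDeriv]
    have hev : (fun q ↦ P q (FiberBundle.extend (Euc d) (V t) q)) =ᶠ[𝓝 (γ t)]
        fun q ↦ Q q (c t) := by
      filter_upwards [e.open_baseSet.mem_nhds hpe] with q hq
      exact congrArg (P q) (e.symmL_apply (R := ℝ) hq _).symm
    rw [hev.mvfderiv_eq]
    rfl
  have hval : A (e ⟨γ t, w - β⟩).2 = P (γ t) w - Q' (c t) := by rw [hew, map_sub, hext]
  constructor
  · intro hc
    have h1 := (hQ'.clm_apply hc).congr_of_eventuallyEq hfc
    have h2 : Q' (c t) + Q (γ t) (e ⟨γ t, w - β⟩).2 = P (γ t) w := by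
      rw [hA]
      exact (congrArg (Q' (c t) + ·) hval).trans (add_sub_cancel _ _)
    exact h2 ▸ h1
  · intro hf
    -- Conversely `c = Q⁻¹ (P V)` is differentiable. The value of `c'` is then read off from the
    -- product rule, as `Q (γ t)` is injective.
    have hcf : c =ᶠ[𝓝 t] fun s ↦ (Q (γ s)).inverse (P (γ s) (V s)) := by
      filter_upwards [hbase] with s hs
      let B : Euc d ≃L[ℝ] Euc d := (e.continuousLinearEquivAt ℝ (γ s) hs).symm.trans (P (γ s))
      have hB : Q (γ s) = B := by
        ext1 v
        exact congrArg (P (γ s))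
          (congrFun (e.symm_continuousLinearEquivAt_eq (R := ℝ) hs) v).symm
      rw [hB, ContinuousLinearMap.inverse_equiv]
      refine (B.symm_apply_apply (c s)).symm.trans (congrArg B.symm ?_)
      exact congrArg (P (γ s)) ((e.continuousLinearEquivAt ℝ (γ s) hs).symm_apply_apply (V s))
    have hJ : DifferentiableAt ℝ (fun s ↦ (Q (γ s)).inverse) t := by
      have h1 : DifferentiableAt ℝ (ContinuousLinearMap.inverse : (Euc d →L[ℝ] Euc d) → _)
          (Q (γ t)) := by
        rw [hA]
        exact (contDiffAt_map_inverse (𝕜 := ℝ) (n := 1) A).differentiableAt (by simp)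
      exact h1.comp t hQγ
    have hc := (hJ.hasDerivAt.clm_apply hf).congr_of_eventuallyEq hcf
    have h1 := ((hQ'.clm_apply hc).congr_of_eventuallyEq hfc).unique hf
    have h2 := A.injective ((hAx _).symm.trans ((eq_sub_of_add_eq' h1).trans hval.symm))
    exact hc.congr_deriv h2

end Transport

/-! ### Parallel transport along piecewise curves -/

section Transport

variable {d : ℕ} {M : Type*} [TopologicalSpace M] [ChartedSpace (Euc d) M]

/-- A curve which is continuous on `[a, b]` and differentiable at all but finitely many times. -/
structure IsPiecewiseDifferentiable (d : ℕ) {M : Type*} [TopologicalSpace M]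
    [ChartedSpace (Euc d) M] (γ : ℝ → M) (a b : ℝ) : Prop where
  le : a ≤ b
  continuousOn : ContinuousOn γ (Icc a b)
  mdifferentiableAt :
    ∃ S : Finset ℝ, ∀ t ∈ Ioo a b \ S, MDifferentiableAt 𝓘(ℝ, ℝ) (𝓡 d) γ t

theorem IsPiecewiseDifferentiable.mono {γ : ℝ → M} {a b a' b' : ℝ}
    (h : IsPiecewiseDifferentiable d γ a b) (ha : a ≤ a') (hab : a' ≤ b') (hb : b' ≤ b) :
    IsPiecewiseDifferentiable d γ a' b' := by
  obtain ⟨S, hS⟩ := h.mdifferentiableAt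
  exact ⟨hab, h.continuousOn.mono (Icc_subset_Icc ha hb),
    S, fun t ht ↦ hS t ⟨Ioo_subset_Ioo ha hb ht.1, ht.2⟩⟩

/-- Retains what transport needs, in a form that passes to subintervals without refining the
partition. The exceptional times are the partition points. -/
theorem IsPiecewiseC1.isPiecewiseDifferentiable {γ : ℝ → M} {a b : ℝ}
    (h : IsPiecewiseC1 d γ a b) : IsPiecewiseDifferentiable d γ a b := by
  obtain ⟨n, t, ht, rfl, rfl, hC⟩ := h
  have key : ∀ k ≤ n, ContinuousOn γ (Icc (t 0) (t k)) ∧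
      ∀ s ∈ Ioo (t 0) (t k) \ (Finset.image t (Finset.range (k + 1)) : Finset ℝ),
        MDifferentiableAt 𝓘(ℝ, ℝ) (𝓡 d) γ s := by
    intro k
    induction k with
    | zero => simp
    | succ k ih =>
      intro hk
      obtain ⟨h1, h2⟩ := ih (by omega)
      have h3 := hC k (by omega)
      refine ⟨?_, ?_⟩
      · rw [← Icc_union_Icc_eq_Icc (ht (Nat.zero_le k)) (ht (Nat.le_succ k))]
        exact h1.union_of_isClosed h3.continuousOn isClosed_Icc isClosed_Icc
      · rintro s ⟨hs, hsS⟩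
        rcases lt_trichotomy s (t k) with hlt | rfl | hgt
        · refine h2 s ⟨⟨hs.1, hlt⟩, fun hmem ↦ hsS ?_⟩
          refine Finset.coe_subset.2 (Finset.image_subset_image ?_) hmem
          exact Finset.range_subset_range.2 (by omega)
        · exact (hsS (Finset.mem_coe.2 (Finset.mem_image_of_mem t (by simp)))).elim
        · exact (h3.contMDiffAt (Icc_mem_nhds hgt hs.2)).mdifferentiableAt (by simp)
  exact ⟨ht (Nat.zero_le n), (key n le_rfl).1, _, (key n le_rfl).2⟩

/-- The fundamental theorem of calculus tolerates countably many exceptional points for a continuous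
function. -/
theorem eq_of_hasDerivAt_zero_off_finset {E : Type*} [NormedAddCommGroup E] [NormedSpace ℝ E]
    [CompleteSpace E] {f : ℝ → E} {a b : ℝ} (hab : a ≤ b) (S : Finset ℝ)
    (hc : ContinuousOn f (Icc a b)) (hd : ∀ t ∈ Ioo a b \ S, HasDerivAt f 0 t) : f b = f a := by
  have h := MeasureTheory.integral_eq_of_hasDerivAt_off_countable_of_le f (fun _ ↦ 0) hab
    S.countable_toSet hc hd (by simp)
  rw [intervalIntegral.integral_zero] at h
  exact sub_eq_zero.1 h.symm

variable [IsManifold (𝓡 d) ∞ M]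
  {P : ∀ p : M, TangentSpace (𝓡 d) p ≃L[ℝ] Euc d} {U : Set M}
  {cov : CovariantDerivative (𝓡 d) (Euc d) (fun p : M ↦ TangentSpace (𝓡 d) p)}

/-- A one-form is a smooth function `z ↦ η z.proj z.2` on the part of `TM` over `U`; it is composed
with the continuous curve `t ↦ (γ t, V t)`. -/
theorem IsSmoothOneFormOn.continuousOn_apply
    {η : ∀ p : M, TangentSpace (𝓡 d) p →L[ℝ] Euc d} (hη : IsSmoothOneFormOn η U)
    (hU : IsOpen U) {γ : ℝ → M} {V : ∀ t : ℝ, TangentSpace (𝓡 d) (γ t)} {s : Set ℝ}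
    (hγ : ∀ t ∈ s, γ t ∈ U)
    (hV : ContinuousOn (fun t ↦ (⟨γ t, V t⟩ : TangentBundle (𝓡 d) M)) s) :
    ContinuousOn (fun t ↦ η (γ t) (V t)) s := by
  intro t ht
  have h1 : ContMDiffWithinAt (𝓡 d).tangent 𝓘(ℝ, Euc d) ∞
      (fun z : TangentBundle (𝓡 d) M ↦ η z.proj z.2) univ ⟨γ t, V t⟩ :=
    hη.contMDiffWithinAt_apply hU le_rfl (b := fun z : TangentBundle (𝓡 d) M ↦ z.proj)
      (v := fun z ↦ z.2) (x := ⟨γ t, V t⟩) (hγ t ht) contMDiffWithinAt_id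
  exact (h1.continuousWithinAt.continuousAt Filter.univ_mem).comp_continuousWithinAt
    (f := fun t ↦ (⟨γ t, V t⟩ : TangentBundle (𝓡 d) M)) (hV t ht)

/-- Parallel transport inside the domain of a parallel coframe. -/
theorem IsFlatWith.isParallelTransport (h : IsFlatWith cov P U)
    (hP : IsSmoothOneFormOn (fun p ↦ (P p : TangentSpace (𝓡 d) p →L[ℝ] Euc d)) U)
    (hU : IsOpen U) {γ : ℝ → M} {a b : ℝ} (hγ : IsPiecewiseDifferentiable d γ a b)
    (hγU : ∀ t ∈ Icc a b, γ t ∈ U) :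
    IsParallelTransport cov γ a b (((P (γ b)).symm : Euc d →L[ℝ] TangentSpace (𝓡 d) (γ b)) ∘L
      (P (γ a) : TangentSpace (𝓡 d) (γ a) →L[ℝ] Euc d)) := by
  obtain ⟨S, hS⟩ := hγ.mdifferentiableAt
  -- Existence: the field with constant coordinates `P (γ a) v`. Uniqueness: the coordinates of any
  -- parallel field are continuous with zero derivative off a finite set, hence equal at `a` and
  -- `b`.
  refine ⟨rfl, rfl, fun v ↦ ⟨⟨fun t ↦ (P (γ t)).symm (P (γ a) v), ⟨?_, S, ?_⟩, ?_⟩, ?_⟩⟩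
  · intro t ht
    have h1 := (hP.contMDiffAt_symm_apply hU (hγU t ht)
      (contMDiffAt_const (c := P (γ a) v))).continuousAt
    exact h1.comp_continuousWithinAt (hγ.continuousOn t ht)
  · intro t ht
    rw [h.hasCovDerivAlongAt_iff hP hU (hγU t (Ioo_subset_Icc_self ht.1))]
    refine ⟨hS t ht, ?_⟩
    simp only [map_zero, ContinuousLinearEquiv.apply_symm_apply]
    exact hasDerivAt_const _ _
  · simp
  · rintro V ⟨hVc, S', hV'⟩ hVa
    have hVa' : V a = v := TotalSpace.mk_inj.1 hVa
    have hd : ∀ t ∈ Ioo a b \ S', HasDerivAt (fun s ↦ P (γ s) (V s)) 0 t := fun t ht ↦ by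
      have h1 := ((h.hasCovDerivAlongAt_iff hP hU (hγU t (Ioo_subset_Icc_self ht.1))).1
        (hV' t ht)).2
      rwa [map_zero] at h1
    have h2 := eq_of_hasDerivAt_zero_off_finset hγ.le S' (hP.continuousOn_apply hU hγU hVc) hd
    refine TotalSpace.mk_inj.2 ?_
    rw [← hVa']
    exact (ContinuousLinearEquiv.eq_symm_apply _).2 h2

theorem HasCovDerivAlongAt.congr_of_eventuallyEq {γ : ℝ → M}
    {V V' : ∀ t : ℝ, TangentSpace (𝓡 d) (γ t)} {t : ℝ} {w : TangentSpace (𝓡 d) (γ t)}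
    (h : HasCovDerivAlongAt cov γ V t w) (hV : ∀ᶠ s in 𝓝 t, V' s = V s) :
    HasCovDerivAlongAt cov γ V' t w := by
  refine ⟨h.1, ?_⟩
  rw [hV.self_of_nhds]
  refine h.2.congr_of_eventuallyEq ?_
  filter_upwards [hV] with s hs
  rw [hs]

theorem IsParallelAlong.mono {γ : ℝ → M} {a b a' b' : ℝ}
    {V : ∀ t : ℝ, TangentSpace (𝓡 d) (γ t)} (h : IsParallelAlong cov γ a b V)
    (ha : a ≤ a') (hb : b' ≤ b) : IsParallelAlong cov γ a' b' V := by
  obtain ⟨hc, S, hS⟩ := h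
  exact ⟨hc.mono (Icc_subset_Icc ha hb), S, fun t ht ↦ hS t ⟨Ioo_subset_Ioo ha hb ht.1, ht.2⟩⟩

theorem IsParallelAlong.ite {γ : ℝ → M} {a b c : ℝ} (hac : a ≤ c) (hcb : c ≤ b)
    {V V' : ∀ t : ℝ, TangentSpace (𝓡 d) (γ t)} (h : IsParallelAlong cov γ a c V)
    (h' : IsParallelAlong cov γ c b V') (hV : V c = V' c) :
    IsParallelAlong cov γ a b (fun t ↦ if t ≤ c then V t else V' t) := by
  classical
  obtain ⟨hc, S, hS⟩ := h
  obtain ⟨hc', S', hS'⟩ := h'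
  -- The glued field may have no derivative at the junction `c`, so `c` becomes exceptional; `V c =
  -- V' c` secures continuity there.
  refine ⟨?_, insert c (S ∪ S'), ?_⟩
  · rw [← Icc_union_Icc_eq_Icc hac hcb]
    refine ContinuousOn.union_of_isClosed ?_ ?_ isClosed_Icc isClosed_Icc
    · refine hc.congr fun t ht ↦ ?_
      simp only [if_pos ht.2]
    · refine hc'.congr fun t ht ↦ ?_
      rcases ht.1.eq_or_lt with rfl | hlt
      · simp only [le_refl, if_true, hV]
      · simp only [if_neg hlt.not_ge]
  · rintro t ⟨ht, htS⟩
    simp only [Finset.coe_insert, Finset.coe_union, mem_insert_iff, mem_union, not_or] at htS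
    obtain ⟨htc, htS, htS'⟩ := htS
    rcases lt_or_gt_of_ne htc with hlt | hgt
    · refine (hS t ⟨⟨ht.1, hlt⟩, htS⟩).congr_of_eventuallyEq ?_
      filter_upwards [Iio_mem_nhds hlt] with s hs
      exact if_pos (le_of_lt hs)
    · refine (hS' t ⟨⟨hgt, ht.2⟩, htS'⟩).congr_of_eventuallyEq ?_
      filter_upwards [Ioi_mem_nhds hgt] with s hs
      exact if_neg (not_le_of_gt hs)

/-- Parallel transports along consecutive parts of a curve compose. -/
theorem IsParallelTransport.comp {γ : ℝ → M} {a b c : ℝ} (hac : a ≤ c) (hcb : c ≤ b)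
    {T : TangentSpace (𝓡 d) (γ a) →L[ℝ] TangentSpace (𝓡 d) (γ c)}
    {T' : TangentSpace (𝓡 d) (γ c) →L[ℝ] TangentSpace (𝓡 d) (γ b)}
    (h : IsParallelTransport cov γ a c T) (h' : IsParallelTransport cov γ c b T') :
    IsParallelTransport cov γ a b (T' ∘L T) := by
  refine ⟨rfl, rfl, fun v ↦ ⟨?_, fun V hV hVa ↦ ?_⟩⟩
  · obtain ⟨V, hV, hVa⟩ := (h.2.2 v).1
    obtain ⟨V', hV', hVc⟩ := (h'.2.2 (T v)).1
    have h1 := TotalSpace.mk_inj.1 ((h.2.2 v).2 V hV hVa)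
    have h2 := TotalSpace.mk_inj.1 hVc
    refine ⟨_, hV.ite hac hcb hV' (h1.trans h2.symm), ?_⟩
    simp only [if_pos hac, hVa]
  · exact (h'.2.2 (T v)).2 V (hV.mono hac le_rfl) ((h.2.2 v).2 V (hV.mono le_rfl hcb) hVa)

end Transport

/-! ### Reference charts, the Levi-Civita connection and material transport -/

namespace HyperelasticBody

variable {d : ℕ} {M : Type*} [TopologicalSpace M] [ChartedSpace (Euc d) M]
  [IsManifold (𝓡 d) ∞ M] {B : HyperelasticBody d M} {ι : Type*}

/-- Two reference charts for an undistorted archetype induce the same inner product. -/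
theorem IsReferenceChart.inner_eq {w : (Euc d →L[ℝ] Euc d) → WithTop ℝ} (hw : IsUndistorted w)
    {U V : Set M} {P Q : ∀ p : M, TangentSpace (𝓡 d) p ≃L[ℝ] Euc d}
    (hP : B.IsReferenceChart w U P) (hQ : B.IsReferenceChart w V Q) {p : M} (hpU : p ∈ U)
    (hpV : p ∈ V) (X Y : TangentSpace (𝓡 d) p) :
    (inner ℝ (P p X) (P p Y) : ℝ) = inner ℝ (Q p X) (Q p Y) := by
  -- Evaluating `W_p (C ∘ P p)` in either chart gives `w C = w (C ∘ g)`. So the transition map `g`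
  -- is a symmetry of the undistorted `w`, hence an isometry.
  let g : Euc d ≃L[ℝ] Euc d := (Q p).symm.trans (P p)
  have hg : g ∈ symmetryGroup w := fun C ↦ by
    have h1 := hP.constitutive p hpU (C ∘L (P p : TangentSpace (𝓡 d) p →L[ℝ] Euc d))
    have h2 := hQ.constitutive p hpV (C ∘L (P p : TangentSpace (𝓡 d) p →L[ℝ] Euc d))
    rw [h1] at h2
    refine Eq.trans h2.symm (congrArg w ?_)
    ext1 x
    exact congrArg C ((P p).apply_symm_apply x)
  let gi : Euc d →ₗᵢ[ℝ] Euc d := ⟨(g : Euc d →L[ℝ] Euc d), (hw g hg).1⟩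
  have e : ∀ Z, gi (Q p Z) = P p Z := fun Z ↦ congrArg (P p) ((Q p).symm_apply_apply Z)
  rw [← e, ← e, gi.inner_map_map]

namespace UniformRepresentation

/-- The chart need not belong to the family `R.P`: sharing the archetype already forces the same
metric. This is what lets the chart of a disclination-free sub-body control holonomy. -/
theorem isFlatWith (R : B.UniformRepresentation ι)
    {cov : CovariantDerivative (𝓡 d) (Euc d) (fun p : M ↦ TangentSpace (𝓡 d) p)}
    (hcov : IsLeviCivita R.metric cov) {U : Set M}
    {P : ∀ p : M, TangentSpace (𝓡 d) p ≃L[ℝ] Euc d}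
    (hP : B.IsReferenceChart R.archetype U P)
    (hc : IsClosedOneFormOn (fun p ↦ (P p : TangentSpace (𝓡 d) p →L[ℝ] Euc d)) U) :
    IsFlatWith cov P U := by
  intro p hp σ hσ
  refine hcov.eq_coframeDeriv hP.smooth hc hP.isOpen (fun q hq X Y ↦ ?_) hp hσ
  obtain ⟨α, hα⟩ := R.exists_mem q
  rw [R.metric_inner hα]
  exact (R.isReferenceChart α).inner_eq R.undistorted hP hα hq X Y

theorem exists_isLeviCivita (R : B.UniformRepresentation ι) (hR : R.HasDiscreteDefects) :
    ∃ cov, IsLeviCivita R.metric cov := by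
  choose α hα using R.exists_mem
  -- The chart `α p` may jump with `p`, but no gluing is needed: each condition is checked at one
  -- point, with the coframe `R.P (α p)` held fixed in its neighbourhood.
  refine ⟨⟨fun σ p ↦ coframeDeriv (R.P (α p)) σ p, ⟨fun {σ σ' p} hσ hσ' _ ↦ ?_,
    fun {σ g p} hσ hg _ ↦ ?_⟩⟩, isLeviCivita_iff.2 ⟨fun {X Y p} hX hY ↦ ?_,
    fun {p X σ τ} _ hσ hτ ↦ ?_⟩⟩
  · exact ((R.isReferenceChart (α p)).smooth.isCovariantDerivativeOn_coframeDeriv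
      (R.isReferenceChart (α p)).isOpen).add hσ hσ' (hα p)
  · exact ((R.isReferenceChart (α p)).smooth.isCovariantDerivativeOn_coframeDeriv
      (R.isReferenceChart (α p)).isOpen).leibniz hσ hg (hα p)
  · exact (hR (α p)).coframeDeriv_sub (hα p) hX hY
  · have hev : (fun q ↦ R.metric.inner q (σ q) (τ q)) =ᶠ[𝓝 p]
        fun q ↦ inner ℝ (R.P (α p) q (σ q)) (R.P (α p) q (τ q)) := by
      filter_upwards [(R.isReferenceChart (α p)).isOpen.mem_nhds (hα p)] with q hq
      exact R.metric_inner hq _ _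
    rw [hev.mvfderiv_eq, R.metric_inner (hα p), R.metric_inner (hα p)]
    exact (R.isReferenceChart (α p)).smooth.mvfderiv_inner (R.isReferenceChart (α p)).isOpen
      (hα p) hσ hτ (X p)

variable {cov : CovariantDerivative (𝓡 d) (Euc d) (fun p : M ↦ TangentSpace (𝓡 d) p)}

/-- With `T = P(γ b)⁻¹ P(γ a)`, both energies equal `w (A ∘ P(γ b)⁻¹)`. -/
theorem exists_isParallelTransport_of_subset (R : B.UniformRepresentation ι)
    (hR : R.HasDiscreteDefects) (hcov : IsLeviCivita R.metric cov) {γ : ℝ → M} {a b : ℝ}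
    (hγ : IsPiecewiseDifferentiable d γ a b) {α : ι} (hα : ∀ t ∈ Icc a b, γ t ∈ R.U α) :
    ∃ T : TangentSpace (𝓡 d) (γ a) →L[ℝ] TangentSpace (𝓡 d) (γ b),
      IsParallelTransport cov γ a b T ∧
      ∀ A : TangentSpace (𝓡 d) (γ b) →L[ℝ] Euc d, B.W (γ a) (A ∘L T) = B.W (γ b) A := by
  have hc := R.isReferenceChart α
  refine ⟨_, (R.isFlatWith hcov hc (hR α)).isParallelTransport hc.smooth hc.isOpen hγ hα,
    fun A ↦ ?_⟩
  rw [hc.constitutive _ (hα a (left_mem_Icc.2 hγ.le)),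
    hc.constitutive _ (hα b (right_mem_Icc.2 hγ.le))]
  congr 1
  ext1 x
  exact congrArg (fun y ↦ A ((R.P α (γ b)).symm y)) ((R.P α (γ a)).apply_symm_apply x)

theorem exists_isParallelTransport (R : B.UniformRepresentation ι)
    (hR : R.HasDiscreteDefects) (hcov : IsLeviCivita R.metric cov) {γ : ℝ → M} {a b : ℝ}
    (hγ : IsPiecewiseDifferentiable d γ a b) :
    ∃ T : TangentSpace (𝓡 d) (γ a) →L[ℝ] TangentSpace (𝓡 d) (γ b),
      IsParallelTransport cov γ a b T ∧
      ∀ A : TangentSpace (𝓡 d) (γ b) →L[ℝ] Euc d, B.W (γ a) (A ∘L T) = B.W (γ b) A := by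
  have hγr : Continuous ((Icc a b).domRestrict γ) := hγ.continuousOn.domRestrict
  -- By compactness of `[a, b]` there is a subdivision each of whose pieces `γ` maps into one chart
  -- domain. The sequence `t` equals `b` from index `m` on, so the induction is read off at `m`.
  obtain ⟨t, ht0, htm, ⟨m, hm⟩, ht⟩ := exists_monotone_Icc_subset_open_cover_Icc hγ.le
    (c := fun α ↦ (Icc a b).domRestrict γ ⁻¹' R.U α)
    (fun α ↦ (R.isReferenceChart α).isOpen.preimage hγr)
    (fun s _ ↦ mem_iUnion.2 (R.exists_mem (γ s)))
  have key : ∀ n, ∃ T : TangentSpace (𝓡 d) (γ a) →L[ℝ] TangentSpace (𝓡 d) (γ (t n)),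
      IsParallelTransport cov γ a (t n) T ∧
      ∀ A : TangentSpace (𝓡 d) (γ (t n)) →L[ℝ] Euc d,
        B.W (γ a) (A ∘L T) = B.W (γ (t n)) A := by
    intro n
    induction n with
    | zero =>
      obtain ⟨α, hα⟩ := R.exists_mem (γ a)
      rw [ht0]
      refine R.exists_isParallelTransport_of_subset hR hcov (hγ.mono le_rfl le_rfl hγ.le)
        (α := α) fun s hs ↦ ?_
      rwa [le_antisymm hs.2 hs.1]
    | succ n ih =>
      obtain ⟨T, hT, hTW⟩ := ih
      have hle : (t n : ℝ) ≤ t (n + 1) := htm (Nat.le_succ n)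
      obtain ⟨α, hα⟩ := ht n
      obtain ⟨T', hT', hTW'⟩ := R.exists_isParallelTransport_of_subset hR hcov
        (hγ.mono (t n).2.1 hle (t (n + 1)).2.2) (α := α)
        fun s hs ↦ @hα ⟨s, (t n).2.1.trans hs.1, hs.2.trans (t (n + 1)).2.2⟩ hs
      refine ⟨T' ∘L T, hT.comp (t n).2.1 hle hT', fun A ↦ ?_⟩
      rw [← hTW' A, ← hTW (A ∘L T')]
      rfl
  have h := key m
  rwa [hm m le_rfl] at h

end UniformRepresentation

end HyperelasticBody

theorem mainTheorem1 {d : ℕ} {M : Type*} [TopologicalSpace M] [ChartedSpace (Euc d) M]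
    [IsManifold (𝓡 d) ∞ M] [T2Space M] [SecondCountableTopology M]
    (B : HyperelasticBody d M) {ι : Type*} (R : B.UniformRepresentation ι)
    (hR : R.HasDiscreteDefects) :
    (∃ cov, IsLeviCivita R.metric cov) ∧
    ∀ cov, IsLeviCivita R.metric cov →
      IsMaterialConnection cov B ∧
      IsLocallyFlat cov ∧
      (∀ M' : Set M, R.HasNoDisclinations M' → HasTrivialHolonomyOn cov M') ∧
      (∀ (α : ι) (γ : ℝ → M) (a b : ℝ), IsPiecewiseC1 d γ a b → (∀ t ∈ Icc a b, γ t ∈ R.U α) →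
        IsParallelTransport cov γ a b
          (((R.P α (γ b)).symm : Euc d →L[ℝ] TangentSpace (𝓡 d) (γ b)) ∘L
            (R.P α (γ a) : TangentSpace (𝓡 d) (γ a) →L[ℝ] Euc d))) := by
  refine ⟨R.exists_isLeviCivita hR, fun cov hcov ↦ ⟨⟨⟨⟨fun {σ} hσ p _ ↦ ?_⟩⟩, fun γ a b hγ ↦ ?_⟩,
    fun p X Y Z hX hY hZ ↦ ?_, ?_, fun α γ a b hγ hα ↦ ?_⟩⟩
  · obtain ⟨α, hα⟩ := R.exists_mem p
    have hc := R.isReferenceChart α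
    exact ((R.isFlatWith hcov hc (hR α)).contMDiffAt hc.smooth hc.isOpen hα
      (hσ.contMDiffAt Filter.univ_mem)).contMDiffWithinAt
  · exact R.exists_isParallelTransport hR hcov hγ.isPiecewiseDifferentiable
  · obtain ⟨α, hα⟩ := R.exists_mem p
    have hc := R.isReferenceChart α
    exact (R.isFlatWith hcov hc (hR α)).curvature_eq_zero hc.smooth hc.isOpen hα hX hY hZ
  · rintro M' ⟨P', hc, hd⟩ γ a b p hγ hM' rfl hb
    have h := (R.isFlatWith hcov hc hd).isParallelTransport hc.smooth hc.isOpen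
      hγ.isPiecewiseDifferentiable hM'
    refine ⟨rfl, hb, fun v ↦ ⟨(h.2.2 v).1, fun V hV hVa ↦ ((h.2.2 v).2 V hV hVa).trans ?_⟩⟩
    -- The type of the transport depends on `γ b`; making it a variable lets the two base points be
    -- identified, after which the transport is `P'(p)⁻¹ P'(p) = id`.
    generalize γ b = q at hb
    subst hb
    exact congrArg _ ((P' (γ a)).symm_apply_apply v)
  · have hc := R.isReferenceChart α
    exact (R.isFlatWith hcov hc (hR α)).isParallelTransport hc.smooth hc.isOpen
      hγ.isPiecewiseDifferentiable hα

end
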